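/- Let $\mathbb N=\{1,2,3,\dots\}$. For $n\in\mathbb N$ let $Li_{-n}(t)=\sum_{k\ge 1}k^{n}t^{k}$ ($|t|<1$), and for $n,m\in\mathbb N$ let $A_{n,m}$ be the (unique) real polynomial with $$\frac{d^m}{dt^m}Li_{-n}(t)=\frac{A_{n,m}(t)}{(1-t)^{n+m+1}}\qquad(|t|<1).$$ For $\mu>0$ let $D_{n,m}=\{(z,\zeta)\in\mathbb C^n\times\mathbb C^m:\ \|\zeta\|^2<e^{-\mu\|z\|^2}\}$ (the Fock–Bargmann–Hartogs domain). The Bergman kernel of a domain $\Omega$ is the reproducing kernel of the Hilbert space of holomorphic functions on $\Omega$ that are square integrable with respect to Lebesgue measure, and $\Omega$ is called a Lu Qi-Keng domain if its Bergman kernel has no zeros on $\Omega\times\Omega$. (i) For all $n,m\in\mathbb N$, all complex roots of $A_{n,m}$ and of $A_{n,m+1}$ are real, simple and negative, and $A_{n,m+1}$ strictly alternates $A_{n,m}$: the two polynomials have the same degree $d$, and if $a_1\le\dots\le a_d$ are the roots of $A_{n,m}$ and $b_1\le\dots\le b_d$ those of $A_{n,m+1}$, then $$b_1<a_1<b_2<a_2<\dots<b_d<a_d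 .$$ (ii) For each $n\in\mathbb N$ there is a unique $m_0(n)\in\mathbb N$, not depending on $\mu$, such that for all $\mu>0$ and all $m\in\mathbb N$ the domain $D_{n,m}$ is a Lu Qi-Keng domain if and only if $m\ge m_0(n)$. -/

import Mathlib

open MeasureTheory

noncomputable section

/-! ### Polylogarithms and their derivatives -/

/-- The polylogarithm `Li_s(t) = ∑_{k ≥ 1} t ^ k / k ^ s`; the series converges for `‖t‖ < 1`,
and the function is only used on this disc. -/
def polylog (s t : ℂ) : ℂ :=
  ∑' k : ℕ, t ^ (k + 1) / ((k + 1 : ℕ) : ℂ) ^ s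

/-- `P` is the numerator polynomial of the `m`-th derivative of `Li_{-n}`:
`d^m/dt^m Li_{-n}(t) = P(t) / (1 - t) ^ (n + m + 1)` on the unit disc. -/
def IsPolylogNumerator (n m : ℕ) (P : Polynomial ℝ) : Prop :=
  ∀ t : ℂ, ‖t‖ < 1 →
    iteratedDeriv m (polylog (-(n : ℂ))) t
      = Polynomial.aeval t P / (1 - t) ^ (n + m + 1)

/-! ### Root conditions for real polynomials -/

/-- Every complex root of `P` is real, negative and simple. -/
def RootsRealSimpleNegative (P : Polynomial ℝ) : Prop :=
  ∀ z : ℂ, Polynomial.aeval z P = 0 →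
    ∃ x : ℝ, z = (x : ℂ) ∧ x < 0 ∧ P.rootMultiplicity x = 1

/-- `g` strictly alternates `f`: both have the same degree `d` and only real roots, and the roots
`a` of `f` and `b` of `g`, listed with multiplicity in weakly increasing order, satisfy
`b_1 < a_1 < b_2 < a_2 < ⋯ < b_d < a_d`. -/
def StrictlyAlternates (g f : Polynomial ℝ) : Prop :=
  ∃ (d : ℕ) (a b : Fin d → ℝ),
    f.degree = d ∧ g.degree = d ∧
    f.roots = Finset.univ.val.map a ∧ g.roots = Finset.univ.val.map b ∧
    Monotone a ∧ Monotone b ∧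
    (∀ i : Fin d, b i < a i) ∧
    (∀ i j : Fin d, (i : ℕ) + 1 = (j : ℕ) → a i < b j)

/-! ### Bergman kernels -/

section Bergman

variable {E : Type*} [NormedAddCommGroup E] [NormedSpace ℂ E] [MeasureSpace E]

/-- Membership in the Bergman space of an open set `Ω`: holomorphic and square integrable. -/
def MemBergmanSpace (Ω : Set E) (f : E → ℂ) : Prop :=
  DifferentiableOn ℂ f Ω ∧ MemLp f 2 (volume.restrict Ω)

/-- `K` is the Bergman kernel of the open set `Ω`, the reproducing kernel of the space of
square integrable holomorphic functions on `Ω` (it is determined by this on `Ω × Ω`). -/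
def IsBergmanKernel (Ω : Set E) (K : E → E → ℂ) : Prop :=
  ∀ w ∈ Ω, MemBergmanSpace Ω (fun z => K z w) ∧
    ∀ f : E → ℂ, MemBergmanSpace Ω f →
      f w = ∫ z in Ω, f z * (starRingEnd ℂ) (K z w)

/-- `Ω` is a Lu Qi-Keng domain: its Bergman kernel has no zeros on `Ω × Ω`. -/
def IsLuQiKeng (Ω : Set E) : Prop :=
  ∃ K : E → E → ℂ, IsBergmanKernel Ω K ∧ ∀ z ∈ Ω, ∀ w ∈ Ω, K z w ≠ 0

end Bergman

/-- The Fock–Bargmann–Hartogs domain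
`{(z, ζ) ∈ ℂⁿ × ℂᵐ : ‖ζ‖² < exp (-μ ‖z‖²)}`, with Euclidean norms. -/
def fbhDomain (μ : ℝ) (n m : ℕ) : Set ((Fin n → ℂ) × (Fin m → ℂ)) :=
  {p | ∑ i, ‖p.2 i‖ ^ 2 < Real.exp (-μ * ∑ i, ‖p.1 i‖ ^ 2)}

end

/-!
Write `A_{n,m}` for the numerator of the `m`-th derivative of `Li_{-n}` over
`(1 - t) ^ (n + m + 1)`.
Differentiation gives `A_{n,m+1} = (1 - t) A_{n,m}' + (n + m + 1) A_{n,m}`, and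
`Li_{-(n+1)} = t (d/dt) Li_{-n}` gives `A_{n+1,0} = t A_{n,1}`.

*Roots.* `A_{n,m}` has degree `n` and `A_{n,m} / (1 - t) ^ (n + m + 1)` tends to `0` at `-∞`, so
Rolle's theorem, applied between consecutive roots and between `-∞` and the smallest root, produces
`n` roots of `A_{n,m+1}` that interlace those of `A_{n,m}` (`HasSimpleRoots.derivNumerator`). Since
the roots move to the left, having no root in the open unit disc, that is, having all roots at most
`-1`, persists when `m` grows (`NoZeroInDisc.mono`). It holds eventually because
`∑ 1 / (1 - a_i) = A_{n,m}'(1) / A_{n,m}(1)` is inversely proportional to `n + m`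
(`exists_noZeroInDisc`).

*Bergman kernel.* The kernel of the domain is
`K((z,ζ),(z',ζ')) = μ^n π^{-n-m} e^{mμ⟨z,z'⟩} F(e^{μ⟨z,z'⟩} ⟨ζ,ζ'⟩)`
with `F` the `m`-th derivative of `Li_{-n}`. At the points `(0, s e_i)` the reproducing property reduces to one variable: rotating `z`
and the other coordinates of `ζ`, the mean value property replaces `f` by its restriction to the
axis, and rotating `ζ_i` then isolates the Taylor coefficients (`eq_integral_axisPoint`); the norms
of the monomials `ζ_i ^ k` are computed by a layer cake argument (`lintegral_fbhDomain_norm_pow`).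
The automorphisms `(z, ζ) ↦ (z + a, e^{-μ⟨z,a⟩ - μ‖a‖²/2} U ζ)` carry these points to all others,
and the kernel obeys the transformation law (`isBergmanKernel_fbhKernel`).

The argument of `F` takes every value in the unit disc, so by uniqueness of the Bergman kernel the
domain is Lu Qi-Keng exactly when `A_{n,m}` has no zero there (`isLuQiKeng_fbhDomain_iff`).
-/

noncomputable section

/-! ### Numerators of the derivatives of a polylogarithm -/

section Numerators

open Polynomial

/-- The numerator of the derivative of `P / (1 - t) ^ N`, written over `(1 - t) ^ (N + 1)`. -/
def derivNumerator (N : ℕ) (P : ℝ[X]) : ℝ[X] :=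
  (1 - X) * derivative P + C (N : ℝ) * P

/-- The numerator of `Li_{-n}` over `(1 - t) ^ (n + 1)`. The recursion in `n` is
`Li_{-(n+1)} = t * (d/dt) Li_{-n}`, started at `1 / (1 - t)`, which has the same derivative
as `Li_0 = t / (1 - t)`. -/
def polylogBase : ℕ → ℝ[X]
  | 0 => 1
  | n + 1 => X * derivNumerator (n + 1) (polylogBase n)

/-- The polynomial `A_{n,m}`: the numerator of the `m`-th derivative of `Li_{-n}` over
`(1 - t) ^ (n + m + 1)`. -/
def polylogNumerator (n : ℕ) : ℕ → ℝ[X]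
  | 0 => polylogBase n
  | m + 1 => derivNumerator (n + m + 1) (polylogNumerator n m)

lemma polylogNumerator_succ (n m : ℕ) :
    polylogNumerator n (m + 1) = derivNumerator (n + m + 1) (polylogNumerator n m) := rfl

lemma polylogNumerator_succ_zero (n : ℕ) :
    polylogNumerator (n + 1) 0 = X * polylogNumerator n 1 := rfl

lemma hasDerivAt_div_one_sub_pow {𝕜 : Type*} [NontriviallyNormedField 𝕜] [NormedAlgebra ℝ 𝕜]
    (N : ℕ) (P : ℝ[X]) {x : 𝕜} (hx : x ≠ 1) :
    HasDerivAt (fun y : 𝕜 => aeval y P / (1 - y) ^ N)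
      (aeval x (derivNumerator N P) / (1 - x) ^ (N + 1)) x := by
  have hx' : (1 - x) ≠ 0 := sub_ne_zero.mpr (Ne.symm hx)
  have h1 := P.hasDerivAt_aeval x
  have h2 : HasDerivAt (fun y : 𝕜 => (1 - y) ^ N) (N * (1 - x) ^ (N - 1) * (-1)) x := by
    simpa using ((hasDerivAt_id x).const_sub 1).fun_pow N
  refine (h1.fun_div h2 (pow_ne_zero N hx')).congr_deriv ?_
  simp only [derivNumerator, map_add, map_mul, map_sub, map_one, aeval_X, map_natCast]
  rcases N with _ | N
  · simp only [pow_zero, Nat.cast_zero]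
    field_simp
    ring
  · rw [div_eq_div_iff (pow_ne_zero _ (pow_ne_zero _ hx')) (pow_ne_zero _ hx')]
    simp only [Nat.add_sub_cancel]
    ring

/-- `P` has degree `d`, and its roots, all simple and real, are `a 0 < a 1 < ⋯`. -/
structure HasSimpleRoots {d : ℕ} (P : ℝ[X]) (a : Fin d → ℝ) : Prop where
  ne_zero : P ≠ 0
  natDegree_eq : P.natDegree = d
  strictMono : StrictMono a
  eval_eq_zero : ∀ i, P.eval (a i) = 0

lemma HasSimpleRoots.roots_eq {d : ℕ} {P : ℝ[X]} {a : Fin d → ℝ} (h : HasSimpleRoots P a) :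
    P.roots = Finset.univ.val.map a := by
  have key := roots_eq_of_natDegree_le_card_of_ne_zero (p := P)
    (S := Finset.univ.map ⟨a, h.strictMono.injective⟩) (by simpa using h.eval_eq_zero)
    (by simp [h.natDegree_eq]) h.ne_zero
  simpa using key

lemma HasSimpleRoots.splits {d : ℕ} {P : ℝ[X]} {a : Fin d → ℝ} (h : HasSimpleRoots P a) :
    P.Splits := by
  rw [splits_iff_card_roots, h.roots_eq, h.natDegree_eq]
  simp

lemma HasSimpleRoots.exists_of_aeval_eq_zero {d : ℕ} {P : ℝ[X]} {a : Fin d → ℝ}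
    (h : HasSimpleRoots P a) {z : ℂ} (hz : aeval z P = 0) : ∃ i, z = (a i : ℂ) := by
  have hP := h.splits.eq_prod_roots
  rw [hP, h.roots_eq] at hz
  simp only [Multiset.map_map, map_mul, aeval_C, mul_eq_zero] at hz
  rcases hz with hz | hz
  · simp [h.ne_zero] at hz
  · rw [map_multiset_prod, Multiset.prod_eq_zero_iff] at hz
    simp only [Multiset.map_map, Multiset.mem_map] at hz
    obtain ⟨i, -, hi⟩ := hz
    exact ⟨i, by simpa [sub_eq_zero] using hi⟩

lemma HasSimpleRoots.rootsRealSimpleNegative {d : ℕ} {P : ℝ[X]} {a : Fin d → ℝ}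
    (h : HasSimpleRoots P a) (hneg : ∀ i, a i < 0) : RootsRealSimpleNegative P := by
  intro z hz
  obtain ⟨i, rfl⟩ := h.exists_of_aeval_eq_zero hz
  refine ⟨a i, rfl, hneg i, ?_⟩
  rw [← count_roots, h.roots_eq]
  refine Multiset.count_eq_one_of_mem ?_ (by simp)
  exact (Multiset.nodup_map_iff_of_injective h.strictMono.injective).2 Finset.univ.nodup

lemma natDegree_derivNumerator {N : ℕ} {P : ℝ[X]} (hP : P ≠ 0) (hN : P.natDegree < N) :
    derivNumerator N P ≠ 0 ∧ (derivNumerator N P).natDegree = P.natDegree := by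
  have hcoeff : (derivNumerator N P).coeff P.natDegree = (N - P.natDegree) * P.leadingCoeff := by
    rw [derivNumerator, coeff_add, coeff_C_mul, sub_mul, one_mul, coeff_sub, coeff_derivative,
      coeff_eq_zero_of_natDegree_lt (Nat.lt_succ_self _), leadingCoeff]
    rcases h : P.natDegree with _ | d
    · simp
    · rw [coeff_X_mul, coeff_derivative]
      push_cast
      ring
  have hne : (derivNumerator N P).coeff P.natDegree ≠ 0 := by
    rw [hcoeff]
    refine mul_ne_zero (sub_ne_zero.2 ?_) (leadingCoeff_ne_zero.2 hP)
    exact_mod_cast hN.ne'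
  refine ⟨fun h => hne (by simp [h]), le_antisymm ?_ (le_natDegree_of_ne_zero hne)⟩
  refine (natDegree_add_le _ _).trans (max_le ?_ (natDegree_C_mul_le _ _))
  rcases Nat.eq_zero_or_pos P.natDegree with h0 | h0
  · rw [eq_C_of_natDegree_eq_zero h0]
    simp
  · have h1 : (1 - X : ℝ[X]).natDegree ≤ 1 := by compute_degree
    have h2 := natDegree_derivative_lt h0.ne'
    have h3 := natDegree_mul_le (p := (1 - X : ℝ[X])) (q := derivative P)
    omega

/-- Rolle's theorem for `P / (1 - x) ^ N` between two zeros. -/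
lemma exists_root_derivNumerator_between {N : ℕ} {P : ℝ[X]} {x y : ℝ} (hxy : x < y) (hy : y < 1)
    (hPx : P.eval x = 0) (hPy : P.eval y = 0) :
    ∃ c, x < c ∧ c < y ∧ (derivNumerator N P).eval c = 0 := by
  have hd : ∀ z : ℝ, z < 1 → HasDerivAt (fun y : ℝ => P.eval y / (1 - y) ^ N)
      ((derivNumerator N P).eval z / (1 - z) ^ (N + 1)) z := fun z hz => by
    simpa only [coe_aeval_eq_eval] using hasDerivAt_div_one_sub_pow N P hz.ne
  obtain ⟨c, hc, h⟩ := exists_hasDerivAt_eq_zero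
    (f := fun y : ℝ => P.eval y / (1 - y) ^ N) hxy
    (fun z hz => (hd z (hz.2.trans_lt hy)).continuousAt.continuousWithinAt)
    (by simp [hPx, hPy]) (fun z hz => hd z (hz.2.trans hy))
  have : (1 - c) ^ (N + 1) ≠ 0 := pow_ne_zero _ (by linarith [hc.2])
  exact ⟨c, hc.1, hc.2, by simpa [this] using h⟩

/-- Rolle's theorem for `P / (1 - x) ^ N` between `-∞`, where it tends to `0`, and a zero. -/
lemma exists_root_derivNumerator_lt {N : ℕ} {P : ℝ[X]} (hN : P.natDegree < N) {y : ℝ}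
    (hy : y < 1) (hPy : P.eval y = 0) :
    ∃ c, c < y ∧ (derivNumerator N P).eval c = 0 := by
  have hd : ∀ z : ℝ, z < 1 → HasDerivAt (fun y : ℝ => P.eval y / (1 - y) ^ N)
      ((derivNumerator N P).eval z / (1 - z) ^ (N + 1)) z := fun z hz => by
    simpa only [coe_aeval_eq_eval] using hasDerivAt_div_one_sub_pow N P hz.ne
  have hlim : Filter.Tendsto (fun y : ℝ => P.eval y / (1 - y) ^ N) Filter.atBot (nhds 0) := by
    have h1 : P.degree < ((1 - X : ℝ[X]) ^ N).degree := by
      have : (1 - X : ℝ[X]).degree = 1 := by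
        rw [← neg_sub, degree_neg, ← C_1, degree_X_sub_C]
      rw [degree_pow, this]
      refine degree_le_natDegree.trans_lt ?_
      simpa using hN
    have h2 := Polynomial.div_tendsto_atBot_zero_of_degree_lt P ((1 - X) ^ N) h1
    simpa using h2
  -- the substitution `x = y + 1 - 1 / v` carries `0 < v < 1` to `x < y`
  set s : ℝ → ℝ := fun v => y + 1 - v⁻¹ with hs
  have hs' : ∀ v ∈ Set.Ioo (0 : ℝ) 1, s v < y := fun v hv => by
    have := (one_lt_inv₀ hv.1).2 hv.2
    simp only [hs]
    linarith
  have hsd : ∀ v : ℝ, v ≠ 0 → HasDerivAt s ((v ^ 2)⁻¹) v := fun v hv => by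
    simpa using (hasDerivAt_inv hv).const_sub (y + 1)
  have hl0 : Filter.Tendsto ((fun y : ℝ => P.eval y / (1 - y) ^ N) ∘ s)
      (nhdsWithin 0 (Set.Ioi 0)) (nhds 0) :=
    hlim.comp (Filter.tendsto_atBot_add_const_left _ (y + 1)
      (Filter.tendsto_neg_atTop_atBot.comp tendsto_inv_nhdsGT_zero))
  have hl1 : Filter.Tendsto ((fun y : ℝ => P.eval y / (1 - y) ^ N) ∘ s)
      (nhdsWithin 1 (Set.Iio 1)) (nhds 0) := by
    have h1 : s 1 = y := by simp [hs]
    have h2 : ContinuousAt ((fun y : ℝ => P.eval y / (1 - y) ^ N) ∘ s) 1 :=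
      ContinuousAt.comp (by rw [h1]; exact (hd y hy).continuousAt) (hsd 1 one_ne_zero).continuousAt
    have h3 := h2.tendsto
    simp only [Function.comp_apply, h1, hPy, zero_div] at h3
    exact h3.mono_left nhdsWithin_le_nhds
  obtain ⟨c, hc, h⟩ := exists_hasDerivAt_eq_zero' (zero_lt_one' ℝ) hl0 hl1
    (fun v hv => (hd _ ((hs' v hv).trans hy)).comp v (hsd v hv.1.ne'))
  have h1 : (1 - s c) ^ (N + 1) ≠ 0 := pow_ne_zero _ (by linarith [hs' c hc])
  have h2 : c ≠ 0 := hc.1.ne'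
  exact ⟨s c, hs' c hc, by simpa [h1, h2] using h⟩

lemma HasSimpleRoots.derivNumerator {d N : ℕ} {P : ℝ[X]} {a : Fin d → ℝ}
    (h : HasSimpleRoots P a) (ha : ∀ i, a i < 1) (hN : d < N) :
    ∃ b : Fin d → ℝ, HasSimpleRoots (derivNumerator N P) b ∧ (∀ i, b i < a i) ∧
      ∀ i j : Fin d, (i : ℕ) + 1 = j → a i < b j := by
  have hdeg : P.natDegree < N := h.natDegree_eq ▸ hN
  have key : ∀ j : Fin d, ∃ c, c < a j ∧ (_root_.derivNumerator N P).eval c = 0 ∧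
      ∀ i : Fin d, (i : ℕ) + 1 = j → a i < c := by
    intro j
    by_cases hj : (j : ℕ) = 0
    · obtain ⟨c, hc, hc'⟩ := exists_root_derivNumerator_lt hdeg (ha j) (h.eval_eq_zero j)
      exact ⟨c, hc, hc', fun i hi => by omega⟩
    · set i : Fin d := ⟨j - 1, by omega⟩
      obtain ⟨c, hc1, hc2, hc3⟩ := exists_root_derivNumerator_between (N := N)
        (h.strictMono (show i < j from Fin.lt_def.2 (by simp [i]; omega))) (ha j)
        (h.eval_eq_zero i) (h.eval_eq_zero j)
      refine ⟨c, hc2, hc3, fun i' hi' => ?_⟩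
      have : i' = i := Fin.ext (by simp [i]; omega)
      rwa [this]
  choose b hb1 hb2 hb3 using key
  obtain ⟨h0, h1⟩ := natDegree_derivNumerator h.ne_zero hdeg
  refine ⟨b, ⟨h0, h1.trans h.natDegree_eq, fun i j hij => ?_, hb2⟩, hb1, fun i j hij => hb3 j i hij⟩
  have hlt := Fin.lt_def.1 hij
  set k : Fin d := ⟨j - 1, by omega⟩ with hk
  have hik : i ≤ k := Fin.le_def.2 (by simp [hk]; omega)
  exact (hb1 i).trans_le ((h.strictMono.monotone hik).trans (hb3 j k (by simp [hk]; omega)).le)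

lemma exists_hasSimpleRoots_polylogNumerator_zero (n : ℕ) :
    ∃ a : Fin n → ℝ, HasSimpleRoots (polylogNumerator n 0) a ∧ ∀ i, a i ≤ 0 := by
  induction n with
  | zero => exact ⟨Fin.elim0, ⟨one_ne_zero, natDegree_one, fun i => i.elim0, fun i => i.elim0⟩,
      fun i => i.elim0⟩
  | succ n ih =>
    obtain ⟨a, ha, ha0⟩ := ih
    obtain ⟨b, hb, hba, -⟩ := ha.derivNumerator (N := n + 1)
      (fun i => (ha0 i).trans_lt one_pos) n.lt_succ_self
    have hb0 : ∀ i, b i < 0 := fun i => (hba i).trans_le (ha0 i)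
    refine ⟨Fin.snoc (α := fun _ => ℝ) b 0, ⟨?_, ?_, ?_, ?_⟩, ?_⟩
    · exact mul_ne_zero X_ne_zero hb.ne_zero
    · exact (natDegree_X_mul hb.ne_zero).trans (congrArg (· + 1) hb.natDegree_eq)
    · refine Fin.strictMono_iff_lt_succ.2 fun i => ?_
      rcases Fin.eq_castSucc_or_eq_last i.succ with ⟨j, hj⟩ | hj
      · rw [hj, Fin.snoc_castSucc, Fin.snoc_castSucc]
        refine hb.strictMono (Fin.lt_def.2 ?_)
        have := congrArg Fin.val hj
        simp at this
        omega
      · rw [hj, Fin.snoc_castSucc, Fin.snoc_last]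
        exact hb0 i
    · intro i
      rw [polylogNumerator_succ_zero, eval_mul]
      refine Fin.lastCases ?_ (fun j => ?_) i
      · simp
      · rw [Fin.snoc_castSucc, show polylogNumerator n 1 = _root_.derivNumerator (n + 1) _ from rfl,
          hb.eval_eq_zero, mul_zero]
    · intro i
      refine Fin.lastCases ?_ (fun j => ?_) i
      · simp
      · simpa using (hb0 j).le

/-- The roots of `A_{n,m+1}` are negative and interlace those of `A_{n,m}`. -/
lemma exists_hasSimpleRoots_polylogNumerator (n m : ℕ) :
    ∃ a b : Fin n → ℝ, HasSimpleRoots (polylogNumerator n m) a ∧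
      HasSimpleRoots (polylogNumerator n (m + 1)) b ∧ (∀ i, a i ≤ 0) ∧ (∀ i, b i < 0) ∧
      (∀ i, b i < a i) ∧ ∀ i j : Fin n, (i : ℕ) + 1 = j → a i < b j := by
  induction m with
  | zero =>
    obtain ⟨a, ha, ha0⟩ := exists_hasSimpleRoots_polylogNumerator_zero n
    obtain ⟨b, hb, hba, hab⟩ := ha.derivNumerator (N := n + 1)
      (fun i => (ha0 i).trans_lt one_pos) n.lt_succ_self
    exact ⟨a, b, ha, hb, ha0, fun i => (hba i).trans_le (ha0 i), hba, hab⟩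
  | succ m ih =>
    obtain ⟨-, a, -, ha, -, ha0, -⟩ := ih
    obtain ⟨b, hb, hba, hab⟩ := ha.derivNumerator (N := n + (m + 1) + 1)
      (fun i => (ha0 i).trans one_pos) (by omega)
    exact ⟨a, b, ha, hb, fun i => (ha0 i).le, fun i => (hba i).trans (ha0 i), hba, hab⟩

lemma polylogNumerator_alternates {n m : ℕ} (hm : 1 ≤ m) :
    RootsRealSimpleNegative (polylogNumerator n m) ∧
      RootsRealSimpleNegative (polylogNumerator n (m + 1)) ∧
      StrictlyAlternates (polylogNumerator n (m + 1)) (polylogNumerator n m) := by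
  obtain ⟨k, rfl⟩ : ∃ k, m = k + 1 := ⟨m - 1, by omega⟩
  obtain ⟨-, a', -, ha', -, ha0, -⟩ := exists_hasSimpleRoots_polylogNumerator n k
  obtain ⟨a, b, ha, hb, -, hb0, hba, hab⟩ := exists_hasSimpleRoots_polylogNumerator n (k + 1)
  refine ⟨ha'.rootsRealSimpleNegative ha0, hb.rootsRealSimpleNegative hb0, n, a, b, ?_, ?_,
    ha.roots_eq, hb.roots_eq, ha.strictMono.monotone, hb.strictMono.monotone, hba, hab⟩
  · rw [degree_eq_natDegree ha.ne_zero, ha.natDegree_eq]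
  · rw [degree_eq_natDegree hb.ne_zero, hb.natDegree_eq]

/-! ### Zeros of the numerators in the unit disc -/

/-- `A_{n,m}` has no zero in the open unit disc. -/
def NoZeroInDisc (n m : ℕ) : Prop := ∀ t : ℂ, ‖t‖ < 1 → aeval t (polylogNumerator n m) ≠ 0

lemma HasSimpleRoots.noZeroInDisc_iff {n m : ℕ} {a : Fin n → ℝ}
    (h : HasSimpleRoots (polylogNumerator n m) a) (ha : ∀ i, a i ≤ 0) :
    NoZeroInDisc n m ↔ ∀ i, a i ≤ -1 := by
  constructor
  · intro H i
    by_contra! hi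
    refine H (a i : ℂ) ?_ ?_
    · rw [Complex.norm_real, Real.norm_eq_abs, abs_of_nonpos (ha i)]
      linarith
    · have h1 := aeval_algebraMap_apply ℂ (a i) (polylogNumerator n m)
      rw [Complex.coe_algebraMap] at h1
      rw [h1, coe_aeval_eq_eval, h.eval_eq_zero]
      simp
  · intro H t ht h0
    obtain ⟨i, rfl⟩ := h.exists_of_aeval_eq_zero h0
    rw [Complex.norm_real, Real.norm_eq_abs, abs_of_nonpos (ha i)] at ht
    linarith [H i]

lemma NoZeroInDisc.succ {n m : ℕ} (h : NoZeroInDisc n m) : NoZeroInDisc n (m + 1) := by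
  obtain ⟨a, b, ha, hb, ha0, hb0, hba, -⟩ := exists_hasSimpleRoots_polylogNumerator n m
  rw [ha.noZeroInDisc_iff ha0] at h
  exact (hb.noZeroInDisc_iff fun i => (hb0 i).le).2 fun i => (hba i).le.trans (h i)

lemma NoZeroInDisc.mono {n m k : ℕ} (h : NoZeroInDisc n m) (hk : m ≤ k) : NoZeroInDisc n k :=
  Nat.le_induction h (fun _ _ => NoZeroInDisc.succ) k hk

lemma eval_one_derivNumerator (N : ℕ) (P : ℝ[X]) :
    (derivNumerator N P).eval 1 = N * P.eval 1 := by
  simp [derivNumerator]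

lemma eval_one_derivative_derivNumerator (N : ℕ) (P : ℝ[X]) :
    (derivative (derivNumerator N P)).eval 1 = (N - 1) * (derivative P).eval 1 := by
  simp [derivNumerator]
  ring

/-- At `t = 1` the logarithmic derivative of `A_{n,m}` is inversely proportional to `n + m`. -/
lemma eval_one_derivative_polylogNumerator (n m : ℕ) :
    (n + m) * (derivative (polylogNumerator n m)).eval 1 * (polylogNumerator n 0).eval 1 =
      n * (derivative (polylogNumerator n 0)).eval 1 * (polylogNumerator n m).eval 1 := by
  induction m with
  | zero => simp
  | succ m ih =>
    rw [polylogNumerator_succ, eval_one_derivative_derivNumerator, eval_one_derivNumerator]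
    push_cast
    linear_combination ((n : ℝ) + m + 1) * ih

lemma exists_noZeroInDisc (n : ℕ) : ∃ m, 1 ≤ m ∧ NoZeroInDisc n m := by
  obtain ⟨a₀, -, h₀, -, ha₀, -⟩ := exists_hasSimpleRoots_polylogNumerator n 0
  set P₀ := polylogNumerator n 0
  set s : ℝ := n * ((derivative P₀).eval 1 / P₀.eval 1)
  obtain ⟨m, hm⟩ := exists_nat_ge (max (2 * s) 1)
  have hm1 : (1 : ℝ) ≤ m := (le_max_right _ _).trans hm
  have hms : 2 * s ≤ m := (le_max_left _ _).trans hm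
  obtain ⟨a, -, h, -, ha, -⟩ := exists_hasSimpleRoots_polylogNumerator n m
  refine ⟨m, by exact_mod_cast hm1, (h.noZeroInDisc_iff ha).2 fun i => ?_⟩
  have hne : ∀ {k : ℕ} {c : Fin n → ℝ}, HasSimpleRoots (polylogNumerator n k) c → (∀ i, c i ≤ 0) →
      (polylogNumerator n k).eval 1 ≠ 0 := fun {k c} hc hc0 h1 => by
    obtain ⟨j, hj⟩ := hc.exists_of_aeval_eq_zero (z := 1) (by
      have := aeval_algebraMap_apply ℂ (1 : ℝ) (polylogNumerator n k)
      rw [map_one] at this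
      rw [this, coe_aeval_eq_eval, h1, map_zero])
    have : (1 : ℝ) = c j := by exact_mod_cast hj
    linarith [hc0 j]
  -- the logarithmic derivative at `1` is the sum of the positive numbers `1 / (1 - a i)`
  have hlog : (derivative (polylogNumerator n m)).eval 1 / (polylogNumerator n m).eval 1 =
      ∑ j, 1 / (1 - a j) := by
    rw [h.splits.eval_derivative_div_eval_of_ne_zero (hne h ha), h.roots_eq, Multiset.map_map]
    rfl
  have hsum : (n + m) * ∑ j, 1 / (1 - a j) = s := by
    have h1 := eval_one_derivative_polylogNumerator n m
    have h2 := hne h ha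
    have h3 := hne h₀ ha₀
    rw [← hlog]
    simp only [s, P₀]
    field_simp
    linear_combination h1
  have hle : 1 / (1 - a i) ≤ ∑ j, 1 / (1 - a j) :=
    Finset.single_le_sum (f := fun j => 1 / (1 - a j))
      (fun j _ => one_div_nonneg.2 (by linarith [ha j])) (Finset.mem_univ i)
  have hpos : 0 ≤ ∑ j, 1 / (1 - a j) :=
    Finset.sum_nonneg fun j _ => one_div_nonneg.2 (by linarith [ha j])
  have h4 : (m : ℝ) * ∑ j, 1 / (1 - a j) ≤ m * (1 / 2) := by
    have : (0 : ℝ) ≤ n * ∑ j, 1 / (1 - a j) := by positivity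
    linarith
  have h5 : 1 / (1 - a i) ≤ 1 / 2 := hle.trans (le_of_mul_le_mul_left h4 (by linarith))
  have h6 := (one_div_le_one_div (by linarith [ha i]) two_pos).1 h5
  linarith

end Numerators

/-! ### Power series of the derivatives of a polylogarithm -/

section PowerSeries

open Polynomial

lemma hasSum_deriv_of_hasSum {a : ℕ → ℂ} {F : ℂ → ℂ}
    (h : ∀ t : ℂ, ‖t‖ < 1 → HasSum (fun k => a k * t ^ k) (F t)) {t : ℂ} (ht : ‖t‖ < 1) :
    HasSum (fun k => a (k + 1) * (k + 1) * t ^ k) (deriv F t) := by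
  obtain ⟨r, hr, hr1⟩ := exists_between ht
  have hr0 : 0 ≤ r := (norm_nonneg t).trans hr.le
  have hsum : Summable fun k => ‖a k‖ * r ^ k := by
    have := (h r (by simpa [abs_of_nonneg hr0] using hr1)).summable.norm
    simpa [abs_of_nonneg hr0] using this
  have key := Complex.hasSum_deriv_of_summable_norm (U := Metric.ball (0 : ℂ) r) (z := t)
    (F := fun k w => a k * w ^ k) hsum (fun k => by fun_prop) Metric.isOpen_ball
    (fun k w hw => by
      rw [norm_mul, norm_pow]
      gcongr
      simpa using (mem_ball_zero_iff.1 hw).le) (by simpa using hr)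
  have hF : (fun w => ∑' k, a k * w ^ k) =ᶠ[nhds t] F := by
    filter_upwards [Metric.isOpen_ball.mem_nhds (mem_ball_zero_iff.2 hr)] with w hw
    exact (h w ((mem_ball_zero_iff.1 hw).trans hr1)).tsum_eq
  rw [hF.deriv_eq] at key
  have hk := (hasSum_nat_add_iff' 1).2 key
  simp only [Finset.range_one, Finset.sum_singleton, pow_zero, mul_one, deriv_const,
    sub_zero] at hk
  refine hk.congr_fun fun k => ?_
  simp
  ring

/-- The Taylor coefficients `(j + m) ^ n (j + m)! / j!` at `0` of the `m`-th derivative of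
`Li_{-n}`, for `n ≥ 1`. -/
def polylogCoeff (n m j : ℕ) : ℕ := (j + m) ^ n * (j + m).descFactorial m

lemma polylogCoeff_succ (n m j : ℕ) :
    polylogCoeff n m (j + 1) * (j + 1) = polylogCoeff n (m + 1) j := by
  rw [polylogCoeff, polylogCoeff, Nat.descFactorial_succ, show j + (m + 1) - m = j + 1 by omega,
    show j + 1 + m = j + (m + 1) by ring]
  ring

lemma hasSum_polylogNumerator_succ {n m : ℕ}
    (h : ∀ t : ℂ, ‖t‖ < 1 → HasSum (fun j => (polylogCoeff n m j : ℂ) * t ^ j)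
      (aeval t (polylogNumerator n m) / (1 - t) ^ (n + m + 1))) {t : ℂ} (ht : ‖t‖ < 1) :
    HasSum (fun j => (polylogCoeff n (m + 1) j : ℂ) * t ^ j)
      (aeval t (polylogNumerator n (m + 1)) / (1 - t) ^ (n + (m + 1) + 1)) := by
  have h1 : t ≠ 1 := by
    rintro rfl
    simp at ht
  have key := hasSum_deriv_of_hasSum h ht
  rw [(hasDerivAt_div_one_sub_pow (n + m + 1) (polylogNumerator n m) h1).deriv] at key
  refine key.congr_fun fun j => ?_
  rw [← polylogCoeff_succ]
  push_cast
  ring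

lemma hasSum_polylogNumerator (n m : ℕ) {t : ℂ} (ht : ‖t‖ < 1) :
    HasSum (fun j => (polylogCoeff n m j : ℂ) * t ^ j)
      (aeval t (polylogNumerator n m) / (1 - t) ^ (n + m + 1)) := by
  have hzero : ∀ t : ℂ, ‖t‖ < 1 → HasSum (fun j => (polylogCoeff n 0 j : ℂ) * t ^ j)
      (aeval t (polylogNumerator n 0) / (1 - t) ^ (n + 0 + 1)) := by
    induction n with
    | zero =>
      intro t ht
      simpa [polylogCoeff, polylogNumerator, polylogBase] using hasSum_geometric_of_norm_lt_one ht
    | succ n ih =>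
      intro t ht
      have h1 := (hasSum_polylogNumerator_succ ih ht).mul_left t
      refine (hasSum_nat_add_iff' 1).1 ?_
      rw [polylogNumerator_succ_zero, map_mul, aeval_X, mul_div_assoc]
      simp only [Finset.range_one, Finset.sum_singleton, polylogCoeff, add_zero,
        zero_pow n.succ_ne_zero, zero_mul, Nat.cast_zero, sub_zero]
      refine h1.congr_fun fun j => ?_
      simp only [polylogCoeff, zero_add, Nat.descFactorial_zero, Nat.descFactorial_one]
      push_cast
      ring
  induction m generalizing t with
  | zero => exact hzero t ht
  | succ m ih => exact hasSum_polylogNumerator_succ (fun t ht => ih ht) ht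

lemma polylog_neg_natCast {n : ℕ} (hn : 1 ≤ n) {t : ℂ} (ht : ‖t‖ < 1) :
    polylog (-(n : ℂ)) t = aeval t (polylogNumerator n 0) / (1 - t) ^ (n + 0 + 1) := by
  have h := (hasSum_nat_add_iff' 1).2 (hasSum_polylogNumerator n 0 ht)
  have h0 : n ≠ 0 := by omega
  simp only [Finset.range_one, Finset.sum_singleton, polylogCoeff, zero_add, zero_pow h0,
    Nat.cast_zero, zero_mul, sub_zero] at h
  rw [← h.tsum_eq, polylog]
  refine tsum_congr fun k => ?_
  rw [Complex.cpow_neg, Complex.cpow_natCast]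
  simp
  ring

lemma iteratedDeriv_polylog {n : ℕ} (hn : 1 ≤ n) (m : ℕ) {t : ℂ} (ht : ‖t‖ < 1) :
    iteratedDeriv m (polylog (-(n : ℂ))) t =
      aeval t (polylogNumerator n m) / (1 - t) ^ (n + m + 1) := by
  induction m generalizing t with
  | zero => rw [iteratedDeriv_zero, polylog_neg_natCast hn ht]
  | succ m ih =>
    have h1 : t ≠ 1 := by
      rintro rfl
      simp at ht
    have h2 : iteratedDeriv m (polylog (-(n : ℂ))) =ᶠ[nhds t]
        fun t => aeval t (polylogNumerator n m) / (1 - t) ^ (n + m + 1) := by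
      filter_upwards [Metric.isOpen_ball.mem_nhds (mem_ball_zero_iff.2 ht)] with w hw
      exact ih (mem_ball_zero_iff.1 hw)
    rw [iteratedDeriv_succ, h2.deriv_eq,
      (hasDerivAt_div_one_sub_pow (n + m + 1) (polylogNumerator n m) h1).deriv]
    rfl

lemma isPolylogNumerator_iff {n m : ℕ} (hn : 1 ≤ n) (P : ℝ[X]) :
    IsPolylogNumerator n m P ↔ P = polylogNumerator n m := by
  constructor
  · intro h
    refine eq_of_infinite_eval_eq P _ ((Set.Ioo_infinite (zero_lt_one' ℝ)).mono fun x hx => ?_)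
    have hx1 : ‖(x : ℂ)‖ < 1 := by simpa [abs_of_pos hx.1] using hx.2
    have h1 := h x hx1
    have h2 : (1 - (x : ℂ)) ^ (n + m + 1) ≠ 0 :=
      pow_ne_zero _ (sub_ne_zero.2 (by exact_mod_cast hx.2.ne'))
    rw [iteratedDeriv_polylog hn m hx1, div_left_inj' h2] at h1
    have h3 : ∀ Q : ℝ[X], aeval (x : ℂ) Q = ((Q.eval x : ℝ) : ℂ) := fun Q => by
      simpa using aeval_algebraMap_apply ℂ x Q
    rw [h3, h3] at h1
    exact (Complex.ofReal_injective h1).symm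
  · rintro rfl t ht
    exact iteratedDeriv_polylog hn m ht

/-- The rational function equal to the `m`-th derivative of `Li_{-n}` on the unit disc. -/
def polylogDeriv (n m : ℕ) (t : ℂ) : ℂ := aeval t (polylogNumerator n m) / (1 - t) ^ (n + m + 1)

lemma one_sub_ne_zero_of_norm_lt {t : ℂ} (ht : ‖t‖ < 1) : 1 - t ≠ 0 := by
  rw [sub_ne_zero]
  rintro rfl
  simp at ht

lemma differentiableAt_polylogDeriv (n m : ℕ) {t : ℂ} (ht : ‖t‖ < 1) :
    DifferentiableAt ℂ (polylogDeriv n m) t :=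
  (hasDerivAt_div_one_sub_pow _ _
    (sub_ne_zero.1 (one_sub_ne_zero_of_norm_lt ht)).symm).differentiableAt

lemma polylogDeriv_ne_zero_iff (n m : ℕ) {t : ℂ} (ht : ‖t‖ < 1) :
    polylogDeriv n m t ≠ 0 ↔ aeval t (polylogNumerator n m) ≠ 0 := by
  simp [polylogDeriv, one_sub_ne_zero_of_norm_lt ht]

end PowerSeries

/-! ### Hermitian products and similarities of `ℂ^m` -/

section Hermitian

variable {ι : Type*} [Fintype ι]

/-- The squared Euclidean norm of `x ∈ ℂ^ι`; the norm of the type `ι → ℂ` is the sup norm. -/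
def sqNorm (x : ι → ℂ) : ℝ := ∑ i, ‖x i‖ ^ 2

/-- The standard Hermitian product on `ℂ^ι`, linear in the first variable. -/
def herm (x y : ι → ℂ) : ℂ := ∑ i, x i * starRingEnd ℂ (y i)

lemma sqNorm_nonneg (x : ι → ℂ) : 0 ≤ sqNorm x := Finset.sum_nonneg fun _ _ => by positivity

@[fun_prop]
lemma continuous_sqNorm : Continuous (sqNorm : (ι → ℂ) → ℝ) := by
  unfold sqNorm
  fun_prop

lemma herm_eq_inner (x y : ι → ℂ) : herm x y = inner ℂ (WithLp.toLp 2 y) (WithLp.toLp 2 x) := by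
  simp [herm, PiLp.inner_apply]

lemma sqNorm_eq_norm_sq (x : ι → ℂ) : sqNorm x = ‖(WithLp.toLp 2 x : EuclideanSpace ℂ ι)‖ ^ 2 := by
  rw [EuclideanSpace.norm_sq_eq]
  rfl

lemma herm_self (x : ι → ℂ) : herm x x = sqNorm x := by
  rw [herm_eq_inner, inner_self_eq_norm_sq_to_K, sqNorm_eq_norm_sq]
  simp

lemma norm_herm_sq_le (x y : ι → ℂ) : ‖herm x y‖ ^ 2 ≤ sqNorm x * sqNorm y := by
  rw [herm_eq_inner, sqNorm_eq_norm_sq, sqNorm_eq_norm_sq, ← mul_pow, mul_comm]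
  gcongr
  exact norm_inner_le_norm _ _

lemma sqNorm_add (x y : ι → ℂ) : sqNorm (x + y) = sqNorm x + 2 * (herm x y).re + sqNorm y := by
  rw [sqNorm_eq_norm_sq, sqNorm_eq_norm_sq, sqNorm_eq_norm_sq, WithLp.toLp_add,
    norm_add_sq (𝕜 := ℂ), herm_eq_inner, inner_re_symm]
  rfl

lemma sqNorm_smul (c : ℂ) (x : ι → ℂ) : sqNorm (c • x) = ‖c‖ ^ 2 * sqNorm x := by
  simp [sqNorm, mul_pow, Finset.mul_sum]

lemma herm_add_left (x y z : ι → ℂ) : herm (x + y) z = herm x z + herm y z := by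
  simp [herm, add_mul, Finset.sum_add_distrib]

lemma herm_add_right (x y z : ι → ℂ) : herm x (y + z) = herm x y + herm x z := by
  simp [herm, mul_add, Finset.sum_add_distrib]

lemma herm_smul_left (c : ℂ) (x y : ι → ℂ) : herm (c • x) y = c * herm x y := by
  simp [herm, Finset.mul_sum, mul_assoc]

lemma herm_smul_right (c : ℂ) (x y : ι → ℂ) :
    herm x (c • y) = starRingEnd ℂ c * herm x y := by
  simp [herm, Finset.mul_sum, mul_left_comm]

lemma herm_conj (x y : ι → ℂ) : starRingEnd ℂ (herm x y) = herm y x := by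
  simp [herm, mul_comm]

@[simp]
lemma herm_zero_right (x : ι → ℂ) : herm x 0 = 0 := by simp [herm]

@[simp]
lemma herm_single_right [DecidableEq ι] (x : ι → ℂ) (i : ι) (s : ℂ) :
    herm x (Pi.single i s) = x i * starRingEnd ℂ s := by
  rw [herm, Finset.sum_eq_single i]
  · simp
  · intro j _ hj
    simp [hj]
  · simp

/-- The unitary group acts transitively on spheres: some unitary map takes a multiple of a given
basis vector to `y`. -/
lemma exists_unitary [DecidableEq ι] (i : ι) (y : ι → ℂ) :
    ∃ U : (ι → ℂ) →ₗ[ℂ] (ι → ℂ), (∀ x x', herm (U x) (U x') = herm x x') ∧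
      U (Pi.single i (Real.sqrt (sqNorm y) : ℂ)) = y := by
  set v : EuclideanSpace ℂ ι := WithLp.toLp 2 y with hv
  have hs : Real.sqrt (sqNorm y) = ‖v‖ := by
    rw [sqNorm_eq_norm_sq, Real.sqrt_sq (norm_nonneg _)]
  obtain ⟨w, hw, hwv⟩ : ∃ w : EuclideanSpace ℂ ι, ‖w‖ = 1 ∧ (‖v‖ : ℂ) • w = v := by
    by_cases h : v = 0
    · exact ⟨EuclideanSpace.single i 1, by simp, by simp [h]⟩
    · have h' : (‖v‖ : ℂ) ≠ 0 := by simpa using h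
      refine ⟨(‖v‖ : ℂ)⁻¹ • v, ?_, by rw [smul_smul, mul_inv_cancel₀ h', one_smul]⟩
      rw [norm_smul, norm_inv, Complex.norm_real, norm_norm, inv_mul_cancel₀ (by simpa using h)]
  obtain ⟨b, hb⟩ := Orthonormal.exists_orthonormalBasis_extension_of_card_eq (𝕜 := ℂ)
    (E := EuclideanSpace ℂ ι) (ι := ι) (by simp) (v := fun _ => w) (s := {i})
    ⟨fun j => by simpa using hw, fun j k hjk => absurd (Subsingleton.elim j k) hjk⟩
  refine ⟨(WithLp.linearEquiv 2 ℂ (ι → ℂ)).toLinearMap ∘ₗ b.repr.symm.toLinearEquiv.toLinearMap ∘ₗ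
    (WithLp.linearEquiv 2 ℂ (ι → ℂ)).symm.toLinearMap, fun x x' => ?_, ?_⟩
  · rw [herm_eq_inner, herm_eq_inner]
    exact b.repr.symm.inner_map_map _ _
  · have h1 : (WithLp.toLp 2 (Pi.single i (‖v‖ : ℂ)) : EuclideanSpace ℂ ι) =
        (‖v‖ : ℂ) • EuclideanSpace.single i (1 : ℂ) := by
      ext j
      by_cases hj : j = i
      · subst hj
        simp
      · simp [hj]
    have h2 : b.repr.symm (WithLp.toLp 2 (Pi.single i (‖v‖ : ℂ))) = v := by
      rw [h1, map_smul, b.repr_symm_single, hb i rfl, hwv]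
    rw [hs]
    exact congrArg WithLp.ofLp h2

lemma volume_sqNorm_lt_one_ne_zero : volume {x : ι → ℂ | sqNorm x < 1} ≠ 0 :=
  (isOpen_lt continuous_sqNorm continuous_const).measure_ne_zero _ ⟨0, by simp [sqNorm]⟩

lemma volume_sqNorm_lt_one_ne_top : volume {x : ι → ℂ | sqNorm x < 1} ≠ ⊤ := by
  refine ((measure_mono fun x hx => ?_).trans_lt
    (isCompact_closedBall (0 : ι → ℂ) 1).measure_lt_top).ne
  rw [mem_closedBall_zero_iff, pi_norm_le_iff_of_nonneg zero_le_one]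
  intro i
  have h1 : ‖x i‖ ^ 2 ≤ sqNorm x :=
    Finset.single_le_sum (f := fun i => ‖x i‖ ^ 2) (fun _ _ => by positivity) (Finset.mem_univ i)
  have h2 : sqNorm x < 1 := hx
  exact (sq_le_one_iff₀ (norm_nonneg _)).1 (h1.trans h2.le)

open Pointwise in
/-- Change of variables along a complex linear similarity. The factor is found by comparing the
volumes of two balls, which avoids computing a real determinant. -/
lemma lintegral_comp_similarity {L : (ι → ℂ) →ₗ[ℂ] (ι → ℂ)} {r : ℝ} (hr : 0 < r)
    (hL : ∀ x, sqNorm (L x) = r ^ 2 * sqNorm x) {g : (ι → ℂ) → ENNReal} (hg : Measurable g) :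
    ∫⁻ x, g (L x) * ENNReal.ofReal (r ^ (2 * Fintype.card ι)) = ∫⁻ x, g x := by
  set Lr : (ι → ℂ) →ₗ[ℝ] (ι → ℂ) := L.restrictScalars ℝ with hLr
  have hLm : Measurable Lr := (LinearMap.continuous_of_finiteDimensional Lr).measurable
  have hdet : LinearMap.det Lr ≠ 0 := by
    intro h
    obtain ⟨x, hx, hx0⟩ := (Submodule.ne_bot_iff _).1 (LinearMap.bot_lt_ker_of_det_eq_zero h).ne'
    have h1 := hL x
    rw [show L x = 0 from hx] at h1
    have h2 : sqNorm x = 0 := by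
      have : sqNorm (0 : ι → ℂ) = 0 := by simp [sqNorm]
      rw [this] at h1
      exact (mul_eq_zero.1 h1.symm).resolve_left (pow_ne_zero _ hr.ne')
    refine hx0 (funext fun i => ?_)
    have h3 := (Finset.sum_eq_zero_iff_of_nonneg (fun i _ => by positivity)).1 h2 i
      (Finset.mem_univ i)
    simpa using h3
  have hmap := Measure.map_linearMap_addHaar_eq_smul_addHaar (volume : Measure (ι → ℂ)) hdet
  set c := ENNReal.ofReal |(LinearMap.det Lr)⁻¹|
  set B : Set (ι → ℂ) := {x | sqNorm x < 1}
  have hball : (r • B : Set (ι → ℂ)) = {x | sqNorm x < r ^ 2} := by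
    ext x
    rw [Set.mem_smul_set_iff_inv_smul_mem₀ hr.ne']
    have : r⁻¹ • x = ((r⁻¹ : ℝ) : ℂ) • x := by
      ext i
      simp
    simp only [B, Set.mem_ofPred_eq, this, sqNorm_smul, Complex.norm_real, norm_inv, inv_pow,
      Real.norm_eq_abs, sq_abs]
    rw [inv_mul_lt_one₀ (by positivity)]
  have hpre : Lr ⁻¹' (r • B) = B := by
    ext x
    rw [hball]
    simp only [Set.mem_preimage, Set.mem_ofPred_eq, hLr, LinearMap.coe_restrictScalars, hL, B]
    rw [mul_lt_iff_lt_one_right (by positivity)]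
  have hvol : volume (r • B : Set (ι → ℂ)) =
      ENNReal.ofReal (r ^ (2 * Fintype.card ι)) * volume B := by
    rw [Measure.addHaar_smul, abs_of_pos (by positivity)]
    congr 3
    rw [Module.finrank_pi_fintype]
    simp [mul_comm]
  have hmeas : MeasurableSet (r • B : Set (ι → ℂ)) := by
    rw [hball]
    exact (isOpen_lt continuous_sqNorm continuous_const).measurableSet
  have hc : c * ENNReal.ofReal (r ^ (2 * Fintype.card ι)) = 1 := by
    have h1 : Measure.map Lr volume (r • B) = volume B := by rw [Measure.map_apply hLm hmeas, hpre]
    rw [hmap, Measure.smul_apply, hvol, smul_eq_mul, ← mul_assoc] at h1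
    exact (ENNReal.mul_eq_right volume_sqNorm_lt_one_ne_zero volume_sqNorm_lt_one_ne_top).1 h1
  calc ∫⁻ x, g (L x) * ENNReal.ofReal (r ^ (2 * Fintype.card ι))
      = (∫⁻ x, g (Lr x)) * ENNReal.ofReal (r ^ (2 * Fintype.card ι)) :=
        lintegral_mul_const _ (hg.comp hLm)
    _ = (∫⁻ x, g x ∂(Measure.map Lr volume)) * ENNReal.ofReal (r ^ (2 * Fintype.card ι)) := by
        rw [lintegral_map hg hLm]
    _ = ∫⁻ x, g x := by
        rw [hmap, lintegral_smul_measure, smul_eq_mul, mul_right_comm, hc, one_mul]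

end Hermitian

/-! ### The norms of the monomials -/

section Moments

variable {ι : Type*} [Fintype ι]

lemma integral_norm_pow_mul_exp (k : ℕ) {b : ℝ} (hb : 0 < b) :
    ∫ x : ℂ, ‖x‖ ^ (2 * k) * Real.exp (-b * ‖x‖ ^ 2) = Real.pi * k.factorial / b ^ (k + 1) := by
  have h := Complex.integral_rpow_mul_exp_neg_mul_rpow (p := 2) (q := 2 * k) one_le_two
    (by have : (0 : ℝ) ≤ k := k.cast_nonneg
        linarith) hb
  have h1 : (2 * (k : ℝ) + 2) / 2 = (k : ℝ) + 1 := by ring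
  rw [neg_div, h1, Real.Gamma_nat_eq_factorial, Real.rpow_neg hb.le] at h
  have h2 : ∀ x : ℂ, ‖x‖ ^ (2 * (k : ℝ)) * Real.exp (-b * ‖x‖ ^ (2 : ℝ)) =
      ‖x‖ ^ (2 * k) * Real.exp (-b * ‖x‖ ^ 2) := fun x => by
    rw [Real.rpow_two, ← Real.rpow_natCast ‖x‖ (2 * k)]
    push_cast
    rfl
  simp only [h2] at h
  rw [h]
  have : b ^ ((k : ℝ) + 1) = b ^ (k + 1) := by exact_mod_cast Real.rpow_natCast b (k + 1)
  rw [this]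
  field_simp

lemma lintegral_gaussian_moment [DecidableEq ι] (i : ι) (k : ℕ) :
    ∫⁻ x : ι → ℂ, ENNReal.ofReal (‖x i‖ ^ (2 * k)) * ENNReal.ofReal (Real.exp (-sqNorm x)) =
      ENNReal.ofReal (Real.pi ^ Fintype.card ι * k.factorial) := by
  have h1 : ∀ x : ι → ℂ, ‖x i‖ ^ (2 * k) * Real.exp (-sqNorm x) =
      ∏ j, ‖x j‖ ^ (2 * if j = i then k else 0) * Real.exp (-1 * ‖x j‖ ^ 2) := fun x => by
    rw [Finset.prod_mul_distrib, ← Real.exp_sum, Finset.prod_eq_single i (by simp +contextual)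
      (by simp)]
    simp [sqNorm]
  have h2 : ∫ x : ι → ℂ, ‖x i‖ ^ (2 * k) * Real.exp (-sqNorm x) =
      Real.pi ^ Fintype.card ι * k.factorial := by
    simp only [h1]
    rw [integral_fintype_prod_volume_eq_prod
      (fun j (y : ℂ) => ‖y‖ ^ (2 * if j = i then k else 0) * Real.exp (-1 * ‖y‖ ^ 2))]
    simp only [integral_norm_pow_mul_exp _ one_pos, one_pow, div_one]
    rw [Finset.prod_mul_distrib, Finset.prod_const, Finset.card_univ,
      Finset.prod_eq_single i (by simp +contextual) (by simp)]
    simp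
  have h3 : Integrable fun x : ι → ℂ => ‖x i‖ ^ (2 * k) * Real.exp (-sqNorm x) :=
    Integrable.of_integral_ne_zero (by rw [h2]; positivity)
  rw [← h2, ofReal_integral_eq_lintegral_ofReal h3
    (Filter.Eventually.of_forall fun x => by positivity)]
  exact lintegral_congr fun x => (ENNReal.ofReal_mul (by positivity)).symm

lemma lintegral_gaussian {b : ℝ} (hb : 0 < b) :
    ∫⁻ x : ι → ℂ, ENNReal.ofReal (Real.exp (-b * sqNorm x)) =
      ENNReal.ofReal ((Real.pi / b) ^ Fintype.card ι) := by
  have h1 : ∀ x : ι → ℂ, Real.exp (-b * sqNorm x) = ∏ j, Real.exp (-b * ‖x j‖ ^ 2) := fun x => by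
    rw [← Real.exp_sum, sqNorm, Finset.mul_sum]
  have h2 : ∫ x : ι → ℂ, Real.exp (-b * sqNorm x) = (Real.pi / b) ^ Fintype.card ι := by
    simp only [h1]
    rw [integral_fintype_prod_volume_eq_pow (fun y : ℂ => Real.exp (-b * ‖y‖ ^ 2))]
    congr 1
    simpa using integral_norm_pow_mul_exp 0 hb
  have h3 : Integrable fun x : ι → ℂ => Real.exp (-b * sqNorm x) :=
    Integrable.of_integral_ne_zero (by rw [h2]; positivity)
  rw [← h2, ofReal_integral_eq_lintegral_ofReal h3
    (Filter.Eventually.of_forall fun x => by positivity)]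

/-- The moment `∫ |x_i|^{2k}` over the Euclidean ball of squared radius `R`. -/
def ballMoment (i : ι) (k : ℕ) (R : ℝ) : ENNReal :=
  ∫⁻ x : ι → ℂ, {x | sqNorm x < R}.indicator (fun x => ENNReal.ofReal (‖x i‖ ^ (2 * k))) x

lemma measurable_ballMoment_integrand (i : ι) (k : ℕ) (R : ℝ) :
    Measurable ({x : ι → ℂ | sqNorm x < R}.indicator
      fun x => ENNReal.ofReal (‖x i‖ ^ (2 * k))) :=
  Measurable.indicator (by fun_prop)
    (isOpen_lt continuous_sqNorm continuous_const).measurableSet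

lemma ballMoment_eq_mul (i : ι) (k : ℕ) {R : ℝ} (hR : 0 < R) :
    ballMoment i k R = ENNReal.ofReal (R ^ (k + Fintype.card ι)) * ballMoment i k 1 := by
  have hs : 0 < Real.sqrt R := Real.sqrt_pos.2 hR
  have h := lintegral_comp_similarity (ι := ι) (L := ((Real.sqrt R : ℝ) : ℂ) • LinearMap.id) hs
    (fun x => by
      rw [LinearMap.smul_apply, LinearMap.id_apply, sqNorm_smul, Complex.norm_real,
        Real.norm_eq_abs, sq_abs]) (measurable_ballMoment_integrand i k R)
  rw [ballMoment, ← h, ballMoment,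
    ← lintegral_const_mul _ (measurable_ballMoment_integrand i k 1)]
  refine lintegral_congr fun x => ?_
  rw [LinearMap.smul_apply, LinearMap.id_apply]
  have hmem : sqNorm (((Real.sqrt R : ℝ) : ℂ) • x) < R ↔ sqNorm x < 1 := by
    rw [sqNorm_smul, Complex.norm_real, Real.norm_eq_abs, sq_abs, Real.sq_sqrt hR.le,
      mul_lt_iff_lt_one_right hR]
  by_cases hx : sqNorm x < 1
  · rw [Set.indicator_of_mem (show _ ∈ {x : ι → ℂ | sqNorm x < R} from hmem.2 hx),
      Set.indicator_of_mem (show _ ∈ {x : ι → ℂ | sqNorm x < 1} from hx),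
      ← ENNReal.ofReal_mul (by positivity), ← ENNReal.ofReal_mul (by positivity)]
    congr 1
    have h1 : ∀ j : ℕ, Real.sqrt R ^ (2 * j) = R ^ j := fun j => by
      rw [pow_mul, Real.sq_sqrt hR.le]
    simp only [Pi.smul_apply, smul_eq_mul, norm_mul,
      Complex.norm_real, Real.norm_eq_abs, abs_of_pos hs, mul_pow, h1]
    ring
  · rw [Set.indicator_of_notMem (show _ ∉ {x : ι → ℂ | sqNorm x < R} from fun h => hx (hmem.1 h)),
      Set.indicator_of_notMem (show _ ∉ {x : ι → ℂ | sqNorm x < 1} from hx), zero_mul, mul_zero]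

lemma lintegral_Ioi_exp_neg (c : ℝ) :
    ∫⁻ t in Set.Ioi c, ENNReal.ofReal (Real.exp (-t)) = ENNReal.ofReal (Real.exp (-c)) := by
  rw [← integral_exp_neg_Ioi c, ofReal_integral_eq_lintegral_ofReal (integrableOn_exp_neg_Ioi c)
    (Filter.Eventually.of_forall fun x => by positivity)]

lemma lintegral_Ioi_exp_neg_mul_pow (k : ℕ) :
    ∫⁻ t in Set.Ioi (0 : ℝ), ENNReal.ofReal (Real.exp (-t)) * ENNReal.ofReal (t ^ k) =
      ENNReal.ofReal k.factorial := by
  have h1 : (0 : ℝ) < k + 1 := by positivity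
  have h2 : ∀ t : ℝ, Real.exp (-t) * t ^ ((k : ℝ) + 1 - 1) = Real.exp (-t) * t ^ k := fun t => by
    rw [add_sub_cancel_right, Real.rpow_natCast]
  have h3 := Real.GammaIntegral_convergent h1
  simp only [h2] at h3
  rw [← Real.Gamma_nat_eq_factorial, Real.Gamma_eq_integral h1]
  simp only [h2]
  rw [ofReal_integral_eq_lintegral_ofReal h3]
  · exact lintegral_congr fun t => (ENNReal.ofReal_mul (by positivity)).symm
  · filter_upwards [ae_restrict_mem measurableSet_Ioi] with t ht
    have : 0 < t := ht
    positivity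

/-- The layer cake formula for the weight `exp (-|x|²)` reduces the moments of the unit ball to
Gaussian ones. -/
lemma ballMoment_one (i : ι) (k : ℕ) :
    ballMoment i k 1 = ENNReal.ofReal
      (Real.pi ^ Fintype.card ι * k.factorial / (k + Fintype.card ι).factorial) := by
  classical
  set m := Fintype.card ι
  have h1 : ∫⁻ t in Set.Ioi (0 : ℝ), ENNReal.ofReal (Real.exp (-t)) * ballMoment i k t =
      ENNReal.ofReal ((k + m).factorial) * ballMoment i k 1 := by
    rw [← lintegral_Ioi_exp_neg_mul_pow, ← lintegral_mul_const _ (by fun_prop)]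
    refine setLIntegral_congr_fun measurableSet_Ioi fun t ht => ?_
    rw [ballMoment_eq_mul i k ht, mul_assoc]
  have hset : MeasurableSet {p : ℝ × (ι → ℂ) | sqNorm p.2 < p.1} :=
    (isOpen_lt (by fun_prop) (by fun_prop)).measurableSet
  have h2 : ∫⁻ t in Set.Ioi (0 : ℝ), ENNReal.ofReal (Real.exp (-t)) * ballMoment i k t =
      ENNReal.ofReal (Real.pi ^ m * k.factorial) := by
    rw [← lintegral_gaussian_moment i k]
    calc ∫⁻ t in Set.Ioi (0 : ℝ), ENNReal.ofReal (Real.exp (-t)) * ballMoment i k t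
        = ∫⁻ t in Set.Ioi (0 : ℝ), ∫⁻ x : ι → ℂ,
            {p : ℝ × (ι → ℂ) | sqNorm p.2 < p.1}.indicator (fun p =>
              ENNReal.ofReal (Real.exp (-p.1)) * ENNReal.ofReal (‖p.2 i‖ ^ (2 * k))) (t, x) := by
          refine lintegral_congr fun t => ?_
          rw [ballMoment, ← lintegral_const_mul _ (measurable_ballMoment_integrand i k t)]
          refine lintegral_congr fun x => ?_
          by_cases hx : sqNorm x < t <;> simp [Set.indicator, hx]
      _ = ∫⁻ x : ι → ℂ, ∫⁻ t in Set.Ioi (0 : ℝ),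
            {p : ℝ × (ι → ℂ) | sqNorm p.2 < p.1}.indicator (fun p =>
              ENNReal.ofReal (Real.exp (-p.1)) * ENNReal.ofReal (‖p.2 i‖ ^ (2 * k))) (t, x) := by
          refine lintegral_lintegral_swap (Measurable.aemeasurable ?_)
          exact Measurable.indicator (by fun_prop) hset
      _ = _ := by
          refine lintegral_congr fun x => ?_
          rw [← lintegral_Ioi_exp_neg, ← lintegral_const_mul _ (by fun_prop),
            ← lintegral_indicator measurableSet_Ioi, ← lintegral_indicator measurableSet_Ioi]
          refine lintegral_congr fun t => ?_
          by_cases hx : sqNorm x < t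
          · have : 0 < t := (sqNorm_nonneg x).trans_lt hx
            simp [Set.indicator, hx, this, mul_comm]
          · simp [Set.indicator, hx]
  have h3 : ENNReal.ofReal ((k + m).factorial) ≠ 0 := by
    simp [Nat.factorial_ne_zero]
  rw [h1] at h2
  rw [ENNReal.ofReal_div_of_pos (by positivity), ← h2,
    mul_comm, ENNReal.mul_div_cancel_right h3 ENNReal.ofReal_ne_top]

end Moments

section Domain

variable {μ : ℝ} {n m : ℕ}

lemma mem_fbhDomain {p : (Fin n → ℂ) × (Fin m → ℂ)} :
    p ∈ fbhDomain μ n m ↔ sqNorm p.2 < Real.exp (-μ * sqNorm p.1) := Iff.rfl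

lemma isOpen_fbhDomain : IsOpen (fbhDomain μ n m) :=
  isOpen_lt (f := fun p : (Fin n → ℂ) × (Fin m → ℂ) => sqNorm p.2)
    (g := fun p => Real.exp (-μ * sqNorm p.1)) (by fun_prop) (by fun_prop)

/-- The squared norm of the monomial `ζ_i ^ k` in the Bergman space. -/
lemma lintegral_fbhDomain_norm_pow (hμ : 0 < μ) (i : Fin m) (k : ℕ) :
    ∫⁻ p in fbhDomain μ n m, ENNReal.ofReal (‖p.2 i‖ ^ (2 * k)) =
      ENNReal.ofReal (Real.pi ^ (n + m) / (μ ^ n * polylogCoeff n m k)) := by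
  have hm : 0 < m := i.pos
  rw [← lintegral_indicator isOpen_fbhDomain.measurableSet, Measure.volume_eq_prod,
    lintegral_prod _ (Measurable.aemeasurable
      (Measurable.indicator (by fun_prop) isOpen_fbhDomain.measurableSet))]
  have h1 : ∀ z : Fin n → ℂ, ∫⁻ ζ : Fin m → ℂ, (fbhDomain μ n m).indicator
      (fun p => ENNReal.ofReal (‖p.2 i‖ ^ (2 * k))) (z, ζ) =
      ENNReal.ofReal (Real.exp (-(μ * (k + m)) * sqNorm z)) * ballMoment i k 1 := fun z => by
    calc _ = ballMoment i k (Real.exp (-μ * sqNorm z)) := rfl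
      _ = _ := by
        rw [ballMoment_eq_mul i k (Real.exp_pos _), ← Real.exp_nat_mul, Fintype.card_fin]
        congr 3
        push_cast
        ring
  have hkm : (0 : ℝ) < k + m := by positivity
  rw [lintegral_congr h1, lintegral_mul_const _ (by fun_prop), lintegral_gaussian (by positivity),
    ballMoment_one, ← ENNReal.ofReal_mul (by positivity), Fintype.card_fin, Fintype.card_fin]
  congr 1
  have h2 : ((k + m).descFactorial m : ℝ) = (k + m).factorial / k.factorial := by
    rw [eq_div_iff (by positivity)]
    have := Nat.factorial_mul_descFactorial (n := k + m) (k := m) (by omega)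
    rw [Nat.add_sub_cancel] at this
    rw [← this]
    push_cast
    ring
  rw [polylogCoeff]
  push_cast
  rw [h2, div_pow, mul_pow, pow_add]
  field_simp

end Domain

/-! ### Averaging over circle actions -/

section Averaging

lemma measurePreserving_of_sqNorm_eq {ι : Type*} [Fintype ι] {L : (ι → ℂ) →ₗ[ℂ] (ι → ℂ)}
    (hL : ∀ x, sqNorm (L x) = sqNorm x) : MeasurePreserving L volume volume := by
  have hLm : Measurable L := (LinearMap.continuous_of_finiteDimensional L).measurable
  refine ⟨hLm, Measure.ext fun s hs => ?_⟩
  have h := lintegral_comp_similarity (L := L) one_pos (fun x => by rw [hL, one_pow, one_mul])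
    (g := s.indicator 1) (measurable_one.indicator hs)
  simp only [one_pow, ENNReal.ofReal_one, mul_one] at h
  rw [Measure.map_apply hLm hs, ← lintegral_indicator_one hs, ← h,
    ← lintegral_indicator_one (hLm hs)]
  rfl

lemma integral_circleAverage {α : Type*} [MeasurableSpace α] {ν : Measure α} [SFinite ν]
    {T : ℂ → α → α} (hT : Measurable (Function.uncurry T))
    (hmp : ∀ l, ‖l‖ = 1 → MeasurePreserving (T l) ν ν) {F : α → ℂ} (hF : Integrable F ν) :
    Integrable (fun p => Real.circleAverage (fun l => F (T l p)) 0 1) ν ∧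
      ∫ p, Real.circleAverage (fun l => F (T l p)) 0 1 ∂ν = ∫ p, F p ∂ν := by
  set κ : Measure ℝ := volume.restrict (Set.Ioc 0 (2 * Real.pi))
  set R : ℝ → α → α := fun θ => T (circleMap 0 1 θ)
  have hR : Measurable (Function.uncurry R) :=
    hT.comp (Measurable.prodMk ((continuous_circleMap 0 1).measurable.comp measurable_fst)
      measurable_snd)
  have hRmp : ∀ θ, MeasurePreserving (R θ) ν ν := fun θ => hmp _ (by simp [circleMap])
  have hskew : MeasurePreserving (fun q : ℝ × α => (q.1, R q.1 q.2)) (κ.prod ν) (κ.prod ν) :=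
    (MeasurePreserving.id κ).skew_product hR (Filter.Eventually.of_forall fun θ => (hRmp θ).map_eq)
  have hint : Integrable (fun q : ℝ × α => F (R q.1 q.2)) (κ.prod ν) :=
    hskew.integrable_comp_of_integrable (hF.comp_snd κ)
  have hav : ∀ p, Real.circleAverage (fun l => F (T l p)) 0 1 =
      (2 * Real.pi)⁻¹ • ∫ θ, F (R θ p) ∂κ := fun p => by
    rw [Real.circleAverage_def, intervalIntegral.integral_of_le Real.two_pi_pos.le]
  simp only [hav]
  have hint' := hint.integral_prod_right.smul ((2 * Real.pi)⁻¹ : ℝ)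
  refine ⟨hint', ?_⟩
  have hconst : ∀ θ, ∫ p, F (R θ p) ∂ν = ∫ p, F p ∂ν := fun θ => by
    conv_rhs => rw [← (hRmp θ).map_eq]
    refine (integral_map (hRmp θ).measurable.aemeasurable ?_).symm
    rw [(hRmp θ).map_eq]
    exact hF.aestronglyMeasurable
  rw [integral_smul, ← integral_integral_swap (f := fun θ p => F (R θ p)) hint]
  simp only [hconst]
  rw [integral_const]
  have : κ.real Set.univ = 2 * Real.pi := by
    simp [κ, Real.pi_pos.le]
  rw [this, smul_smul, inv_mul_cancel₀ Real.two_pi_pos.ne', one_smul]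

lemma circleAverage_pow_mul_conj_pow (j k : ℕ) :
    Real.circleAverage (fun l : ℂ => l ^ j * starRingEnd ℂ l ^ k) 0 1 = if j = k then 1 else 0 := by
  have hsph : ∀ l ∈ Metric.sphere (0 : ℂ) |1|, l * starRingEnd ℂ l = 1 := fun l hl => by
    have : ‖l‖ = 1 := by simpa using hl
    rw [Complex.mul_conj, Complex.normSq_eq_norm_sq, this]
    simp
  have hpow : ∀ d, d ≠ 0 → Real.circleAverage (fun l : ℂ => l ^ d) 0 1 = 0 := fun d hd => by
    rw [DiffContOnCl.circleAverage (f := fun l : ℂ => l ^ d)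
      (Differentiable.diffContOnCl (by fun_prop)), zero_pow hd]
  rcases lt_trichotomy j k with h | h | h
  · obtain ⟨d, rfl⟩ := Nat.exists_eq_add_of_lt h
    rw [if_neg (by omega), Real.circleAverage_congr_sphere
      (f₂ := fun l => Complex.conjCLE (l ^ (d + 1))) fun l hl => ?_]
    · have hc := Complex.conjCLE.toContinuousLinearMap.circleAverage_comp_comm (c := 0) (R := 1)
        (f := fun l : ℂ => l ^ (d + 1))
        (ContinuousOn.circleIntegrable' (Continuous.continuousOn (by fun_prop)))
      rw [hpow _ d.succ_ne_zero, map_zero] at hc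
      exact hc
    · simp only [Complex.conjCLE_apply, map_pow]
      rw [add_assoc, pow_add, ← mul_assoc, ← mul_pow, hsph l hl, one_pow, one_mul]
  · subst h
    rw [if_pos rfl, Real.circleAverage_congr_sphere (f₂ := fun _ => 1) fun l hl => ?_,
      Real.circleAverage_const]
    simp only
    rw [← mul_pow, hsph l hl, one_pow]
  · obtain ⟨d, rfl⟩ := Nat.exists_eq_add_of_lt h
    rw [if_neg (by omega), Real.circleAverage_congr_sphere
      (f₂ := fun l => l ^ (d + 1)) fun l hl => ?_, hpow _ d.succ_ne_zero]
    simp only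
    rw [add_assoc, pow_add, mul_right_comm, ← mul_pow, hsph l hl, one_pow, one_mul]

/-- The `k`-th Fourier coefficient of a holomorphic function on a circle is its `k`-th Taylor
coefficient. -/
lemma circleAverage_mul_conj_pow {g : ℂ → ℂ} {a : ℕ → ℂ}
    (hg : ∀ y : ℂ, ‖y‖ < 1 → HasSum (fun j => a j * y ^ j) (g y)) (k : ℕ) {x : ℂ} (hx : ‖x‖ < 1) :
    Real.circleAverage (fun l => g (l * x) * starRingEnd ℂ (l * x) ^ k) 0 1 =
      a k * (x ^ k * starRingEnd ℂ x ^ k) := by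
  set F : ℕ → ℝ → ℂ := fun j θ => (a j * x ^ j * starRingEnd ℂ x ^ k) *
    (circleMap 0 1 θ ^ j * starRingEnd ℂ (circleMap 0 1 θ) ^ k)
  have hFnorm : ∀ j θ, ‖F j θ‖ = ‖a j * x ^ j‖ * ‖x‖ ^ k := fun j θ => by
    simp [F, circleMap]
  have hFc : ∀ j, Continuous (F j) := fun j => by
    have := continuous_circleMap 0 1
    fun_prop
  have hsum := hasSum_integral_of_summable_integral_norm
    (μ := volume.restrict (Set.Ioc 0 (2 * Real.pi))) (F := F)
    (fun j => (hFc j).integrableOn_Ioc) (by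
      simp only [hFnorm, integral_const]
      exact ((hg x hx).summable.norm.mul_right _).mul_left _)
  have hF : ∀ θ, HasSum (fun j => F j θ)
      (g (circleMap 0 1 θ * x) * starRingEnd ℂ (circleMap 0 1 θ * x) ^ k) := fun θ => by
    have h1 := (hg (circleMap 0 1 θ * x) (by simpa [circleMap] using hx)).mul_right
      (starRingEnd ℂ (circleMap 0 1 θ * x) ^ k)
    refine h1.congr_fun fun j => ?_
    simp only [F, map_mul, mul_pow]
    ring
  have hterm : ∀ j, ∫ θ in Set.Ioc 0 (2 * Real.pi), F j θ =
      (a j * x ^ j * starRingEnd ℂ x ^ k) * ((2 * Real.pi) • if j = k then 1 else 0) := fun j => by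
    rw [← circleAverage_pow_mul_conj_pow, Real.circleAverage_def, smul_smul,
      mul_inv_cancel₀ Real.two_pi_pos.ne', one_smul,
      intervalIntegral.integral_of_le Real.two_pi_pos.le, ← integral_const_mul]
  have hsum' := hsum.unique (hasSum_single k fun j hj => by
    rw [hterm, if_neg hj, smul_zero, mul_zero])
  rw [Real.circleAverage_def, intervalIntegral.integral_of_le Real.two_pi_pos.le]
  simp only [← (hF _).tsum_eq]
  rw [hsum', hterm, if_pos rfl, mul_smul_comm, smul_smul, inv_mul_cancel₀ Real.two_pi_pos.ne',
    one_smul]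
  ring

lemma hasSum_taylor_disc {g : ℂ → ℂ} (hg : DifferentiableOn ℂ g (Metric.ball 0 1)) {y : ℂ}
    (hy : ‖y‖ < 1) :
    HasSum (fun j => ((j.factorial : ℂ)⁻¹ * iteratedDeriv j g 0) * y ^ j) (g y) := by
  refine (Complex.hasSum_taylorSeries_on_ball hg (mem_ball_zero_iff.2 hy)).congr_fun fun j => ?_
  simp only [sub_zero, smul_eq_mul]
  ring

end Averaging

/-! ### The reproducing property on the axis `z = 0`, `ζ = s e_i` -/

section BasePoint

variable {μ : ℝ} {n m : ℕ}

/-- The action of the torus on `ℂ^n × ℂ^m` by coordinatewise multiplication. -/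
def torusAct (u : Fin n → ℂ) (v : Fin m → ℂ) (p : (Fin n → ℂ) × (Fin m → ℂ)) :
    (Fin n → ℂ) × (Fin m → ℂ) := (u * p.1, v * p.2)

lemma sqNorm_mul_le {ι : Type*} [Fintype ι] {u : ι → ℂ} (hu : ∀ j, ‖u j‖ ≤ 1) (x : ι → ℂ) :
    sqNorm (u * x) ≤ sqNorm x := by
  refine Finset.sum_le_sum fun j _ => ?_
  rw [Pi.mul_apply, norm_mul]
  gcongr
  exact mul_le_of_le_one_left (norm_nonneg _) (hu j)

lemma sqNorm_mul_eq {ι : Type*} [Fintype ι] {u : ι → ℂ} (hu : ∀ j, ‖u j‖ = 1) (x : ι → ℂ) :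
    sqNorm (u * x) = sqNorm x := by
  simp [sqNorm, hu]

/-- The domain is a complete Reinhardt domain. -/
lemma torusAct_mem (hμ : 0 < μ) {u : Fin n → ℂ} {v : Fin m → ℂ} (hu : ∀ j, ‖u j‖ ≤ 1)
    (hv : ∀ j, ‖v j‖ ≤ 1) {p : (Fin n → ℂ) × (Fin m → ℂ)} (hp : p ∈ fbhDomain μ n m) :
    torusAct u v p ∈ fbhDomain μ n m := by
  rw [mem_fbhDomain] at hp ⊢
  refine (sqNorm_mul_le hv p.2).trans_lt (hp.trans_le (Real.exp_le_exp.2 ?_))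
  exact mul_le_mul_of_nonpos_left (sqNorm_mul_le hu p.1) (by linarith)

lemma measurePreserving_torusAct {u : Fin n → ℂ} {v : Fin m → ℂ} (hu : ∀ j, ‖u j‖ = 1)
    (hv : ∀ j, ‖v j‖ = 1) :
    MeasurePreserving (torusAct u v) (volume.restrict (fbhDomain μ n m))
      (volume.restrict (fbhDomain μ n m)) := by
  have h1 : MeasurePreserving (torusAct u v) volume volume :=
    (measurePreserving_of_sqNorm_eq (L := LinearMap.mulLeft ℂ u) (sqNorm_mul_eq hu)).prod
      (measurePreserving_of_sqNorm_eq (L := LinearMap.mulLeft ℂ v) (sqNorm_mul_eq hv))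
  have h2 := h1.restrict_preimage (isOpen_fbhDomain (μ := μ) (n := n) (m := m)).measurableSet
  have h3 : torusAct u v ⁻¹' fbhDomain μ n m = fbhDomain μ n m := by
    ext p
    simp only [Set.mem_preimage, mem_fbhDomain, torusAct, sqNorm_mul_eq hu, sqNorm_mul_eq hv]
  rwa [h3] at h2

lemma norm_apply_lt_one (hμ : 0 < μ) {p : (Fin n → ℂ) × (Fin m → ℂ)} (hp : p ∈ fbhDomain μ n m)
    (i : Fin m) : ‖p.2 i‖ < 1 := by
  have h1 : ‖p.2 i‖ ^ 2 ≤ sqNorm p.2 :=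
    Finset.single_le_sum (f := fun i => ‖p.2 i‖ ^ 2) (fun _ _ => by positivity) (Finset.mem_univ i)
  have h2 : Real.exp (-μ * sqNorm p.1) ≤ 1 :=
    Real.exp_le_one_iff.2 (by nlinarith [sqNorm_nonneg p.1])
  have h3 : ‖p.2 i‖ ^ 2 < 1 := h1.trans_lt ((mem_fbhDomain.1 hp).trans_le h2)
  exact (sq_lt_one_iff₀ (norm_nonneg _)).1 h3

/-- The point `(0, s e_i)`. -/
def axisPoint (n : ℕ) (i : Fin m) (s : ℂ) : (Fin n → ℂ) × (Fin m → ℂ) := (0, Pi.single i s)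

lemma axisPoint_mem (i : Fin m) {s : ℂ} (hs : ‖s‖ < 1) : axisPoint n i s ∈ fbhDomain μ n m := by
  have h1 : sqNorm (Pi.single i s : Fin m → ℂ) = ‖s‖ ^ 2 := by
    rw [sqNorm, Finset.sum_eq_single i (fun j _ hj => by simp [hj]) (by simp), Pi.single_eq_same]
  have h2 : sqNorm (0 : Fin n → ℂ) = 0 := by simp [sqNorm]
  rw [mem_fbhDomain, axisPoint, h1, h2, mul_zero, Real.exp_zero]
  exact (sq_lt_one_iff₀ (norm_nonneg _)).2 hs

lemma differentiable_axisPoint (i : Fin m) : Differentiable ℂ (axisPoint n i) := by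
  refine (differentiable_const _).prodMk (differentiable_pi.2 fun j => ?_)
  by_cases hj : j = i
  · subst hj
    simp
  · simp [hj]

instance isFiniteMeasure_fbhDomain [hμ : Fact (0 < μ)] [NeZero m] :
    IsFiniteMeasure (volume.restrict (fbhDomain μ n m)) := by
  refine ⟨?_⟩
  have h := lintegral_fbhDomain_norm_pow (n := n) hμ.out (0 : Fin m) 0
  simp only [mul_zero, pow_zero, ENNReal.ofReal_one, lintegral_one] at h
  rw [h]
  exact ENNReal.ofReal_lt_top

lemma MemBergmanSpace.integrable [Fact (0 < μ)] [NeZero m] {f : (Fin n → ℂ) × (Fin m → ℂ) → ℂ}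
    (hf : MemBergmanSpace (fbhDomain μ n m) f) :
    Integrable f (volume.restrict (fbhDomain μ n m)) :=
  hf.2.integrable one_le_two

/-- Rotating `z` and all coordinates of `ζ` but the `i`-th, the mean value property replaces `f` by
its restriction to the axis. -/
lemma integral_mul_conj_pow_eq_axis (hμ : 0 < μ) {f : (Fin n → ℂ) × (Fin m → ℂ) → ℂ}
    (hf : DifferentiableOn ℂ f (fbhDomain μ n m))
    (hfi : Integrable f (volume.restrict (fbhDomain μ n m))) (i : Fin m) (k : ℕ) :
    IntegrableOn (fun p => f (axisPoint n i (p.2 i)) * starRingEnd ℂ (p.2 i) ^ k)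
        (fbhDomain μ n m) ∧
      ∫ p in fbhDomain μ n m, f p * starRingEnd ℂ (p.2 i) ^ k =
        ∫ p in fbhDomain μ n m, f (axisPoint n i (p.2 i)) * starRingEnd ℂ (p.2 i) ^ k := by
  set T : ℂ → (Fin n → ℂ) × (Fin m → ℂ) → (Fin n → ℂ) × (Fin m → ℂ) := fun l =>
    torusAct (fun _ => l) (fun j => if j = i then 1 else l) with hT
  have hTm : Continuous (Function.uncurry T) := by
    refine Continuous.prodMk ?_ ?_
    · exact continuous_pi fun j => by
        simp only [Pi.mul_apply]
        fun_prop
    · refine continuous_pi fun j => ?_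
      simp only [Pi.mul_apply]
      split_ifs <;> fun_prop
  have hTd : ∀ p, Differentiable ℂ fun l => T l p := fun p => by
    refine Differentiable.prodMk ?_ ?_
    · exact differentiable_pi.2 fun j => by
        simp only [Pi.mul_apply]
        fun_prop
    · refine differentiable_pi.2 fun j => ?_
      simp only [Pi.mul_apply]
      split_ifs <;> fun_prop
  have hTi : ∀ l p, (T l p).2 i = p.2 i := fun l p => by simp [hT, torusAct]
  have hT0 : ∀ p, T 0 p = axisPoint n i (p.2 i) := fun p => by
    refine Prod.ext ?_ ?_
    · ext j
      simp [hT, torusAct, axisPoint]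
    · ext j
      by_cases hj : j = i
      · subst hj
        simp [hT, torusAct, axisPoint]
      · simp [hT, torusAct, axisPoint, hj]
  have hF : IntegrableOn (fun p => f p * starRingEnd ℂ (p.2 i) ^ k) (fbhDomain μ n m) := by
    refine Integrable.mul_bdd (c := 1) hfi
      (Continuous.aestronglyMeasurable (by fun_prop)) ?_
    filter_upwards [ae_restrict_mem isOpen_fbhDomain.measurableSet] with p hp
    rw [norm_pow, RCLike.norm_conj]
    exact pow_le_one₀ (norm_nonneg _) (norm_apply_lt_one hμ hp i).le
  obtain ⟨h1, h2⟩ := integral_circleAverage (T := T) hTm.measurable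
    (fun l hl => measurePreserving_torusAct (fun _ => hl) (fun j => by split_ifs <;> simp [hl])) hF
  have hav : ∀ p ∈ fbhDomain μ n m,
      Real.circleAverage (fun l => f (T l p) * starRingEnd ℂ ((T l p).2 i) ^ k) 0 1 =
        f (axisPoint n i (p.2 i)) * starRingEnd ℂ (p.2 i) ^ k := fun p hp => by
    simp only [hTi]
    have hd : DifferentiableOn ℂ (fun l => f (T l p) * starRingEnd ℂ (p.2 i) ^ k)
        (closure (Metric.ball 0 |1|)) := by
      refine DifferentiableOn.mul_const (hf.comp (hTd p).differentiableOn fun l hl => ?_) _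
      have hl' : ‖l‖ ≤ 1 := by
        simpa using Metric.closure_ball_subset_closedBall hl
      exact torusAct_mem hμ (fun _ => hl') (fun j => by split_ifs <;> simp [hl']) hp
    rw [hd.diffContOnCl.circleAverage, hT0]
  refine ⟨h1.congr ?_, ?_⟩
  · filter_upwards [ae_restrict_mem isOpen_fbhDomain.measurableSet] with p hp using hav p hp
  · rw [← h2]
    exact setIntegral_congr_fun isOpen_fbhDomain.measurableSet hav

/-- Pairing with the monomial `ζ_i ^ k` picks out a Taylor coefficient along the axis. -/
lemma integral_mul_conj_pow (hμ : 0 < μ) {f : (Fin n → ℂ) × (Fin m → ℂ) → ℂ}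
    (hf : DifferentiableOn ℂ f (fbhDomain μ n m))
    (hfi : Integrable f (volume.restrict (fbhDomain μ n m))) (i : Fin m) (k : ℕ) :
    ∫ p in fbhDomain μ n m, f p * starRingEnd ℂ (p.2 i) ^ k =
      ((k.factorial : ℂ)⁻¹ * iteratedDeriv k (fun x => f (axisPoint n i x)) 0) *
        (Real.pi ^ (n + m) / (μ ^ n * polylogCoeff n m k) : ℝ) := by
  obtain ⟨hint, heq⟩ := integral_mul_conj_pow_eq_axis hμ hf hfi i k
  set g : ℂ → ℂ := fun x => f (axisPoint n i x) with hg
  have hgd : DifferentiableOn ℂ g (Metric.ball 0 1) :=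
    hf.comp (differentiable_axisPoint i).differentiableOn
      fun x hx => axisPoint_mem i (mem_ball_zero_iff.1 hx)
  set T : ℂ → (Fin n → ℂ) × (Fin m → ℂ) → (Fin n → ℂ) × (Fin m → ℂ) := fun l =>
    torusAct (fun _ => 1) (fun j => if j = i then l else 1) with hT
  have hTm : Continuous (Function.uncurry T) := by
    refine Continuous.prodMk ?_ ?_
    · exact continuous_pi fun j => by
        simp only [Pi.mul_apply]
        fun_prop
    · refine continuous_pi fun j => ?_
      simp only [Pi.mul_apply]
      split_ifs <;> fun_prop
  have hTi : ∀ l p, (T l p).2 i = l * p.2 i := fun l p => by simp [hT, torusAct]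
  obtain ⟨-, h2⟩ := integral_circleAverage (T := T) hTm.measurable
    (fun l hl => measurePreserving_torusAct (fun _ => by simp)
      (fun j => by split_ifs <;> simp [hl])) hint
  rw [heq, ← h2]
  simp only [hTi]
  rw [setIntegral_congr_fun isOpen_fbhDomain.measurableSet fun p hp =>
    circleAverage_mul_conj_pow (fun y hy => hasSum_taylor_disc hgd hy) k
      (norm_apply_lt_one hμ hp i), integral_const_mul]
  congr 1
  have h3 : ∀ p : (Fin n → ℂ) × (Fin m → ℂ), p.2 i ^ k * starRingEnd ℂ (p.2 i) ^ k =
      ((‖p.2 i‖ ^ (2 * k) : ℝ) : ℂ) := fun p => by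
    rw [← mul_pow, Complex.mul_conj, Complex.normSq_eq_norm_sq]
    push_cast
    rw [pow_mul]
  simp only [h3]
  rw [integral_complex_ofReal, integral_eq_lintegral_of_nonneg_ae
    (Filter.Eventually.of_forall fun p => by positivity)
    (Continuous.aestronglyMeasurable (by fun_prop)), lintegral_fbhDomain_norm_pow hμ,
    ENNReal.toReal_ofReal (by positivity)]

/-- The reproducing property at the points of the axis. -/
lemma eq_integral_axisPoint (hμ : 0 < μ) {f : (Fin n → ℂ) × (Fin m → ℂ) → ℂ}
    (hf : DifferentiableOn ℂ f (fbhDomain μ n m))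
    (hfi : Integrable f (volume.restrict (fbhDomain μ n m))) (i : Fin m) {s : ℂ} (hs : ‖s‖ < 1) :
    f (axisPoint n i s) = ∫ p in fbhDomain μ n m, f p * starRingEnd ℂ
      ((μ ^ n / Real.pi ^ (n + m) : ℝ) * polylogDeriv n m (p.2 i * starRingEnd ℂ s)) := by
  have hm : 0 < m := i.pos
  set C : ℝ := μ ^ n / Real.pi ^ (n + m)
  have hC : 0 < C := by positivity
  have hc : ∀ k, (0 : ℝ) < polylogCoeff n m k := fun k => by
    have : 0 < polylogCoeff n m k :=
      Nat.mul_pos (by positivity) (Nat.descFactorial_pos.2 (by omega))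
    exact_mod_cast this
  set F : ℕ → (Fin n → ℂ) × (Fin m → ℂ) → ℂ := fun k p =>
    (C * polylogCoeff n m k * s ^ k) * (f p * starRingEnd ℂ (p.2 i) ^ k) with hFdef
  have hF1 : ∀ k, IntegrableOn (fun p => f p * starRingEnd ℂ (p.2 i) ^ k) (fbhDomain μ n m) := by
    intro k
    refine Integrable.mul_bdd (c := 1) hfi
      (Continuous.aestronglyMeasurable (by fun_prop)) ?_
    filter_upwards [ae_restrict_mem isOpen_fbhDomain.measurableSet] with p hp
    rw [norm_pow, RCLike.norm_conj]
    exact pow_le_one₀ (norm_nonneg _) (norm_apply_lt_one hμ hp i).le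
  have hFi : ∀ k, Integrable (F k) (volume.restrict (fbhDomain μ n m)) := fun k =>
    (hF1 k).const_mul _
  have hs' : Summable fun k => ‖(C : ℂ) * polylogCoeff n m k * s ^ k‖ := by
    have := ((hasSum_polylogNumerator n m hs).mul_left (C : ℂ)).summable.norm
    simpa only [mul_assoc] using this
  have hsum := hasSum_integral_of_summable_integral_norm hFi (by
    refine Summable.of_nonneg_of_le (fun k => integral_nonneg fun p => norm_nonneg _)
      (fun k => ?_) (hs'.mul_right (∫ p in fbhDomain μ n m, ‖f p‖))
    rw [← integral_const_mul]
    refine setIntegral_mono_on (hFi k).norm (hfi.norm.const_mul _)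
      isOpen_fbhDomain.measurableSet fun p hp => ?_
    simp only [hFdef]
    rw [norm_mul, norm_mul (f p), norm_pow, RCLike.norm_conj]
    gcongr
    exact mul_le_of_le_one_right (norm_nonneg _)
      (pow_le_one₀ (norm_nonneg _) (norm_apply_lt_one hμ hp i).le))
  have hterm : ∀ k, ∫ p in fbhDomain μ n m, F k p =
      ((k.factorial : ℂ)⁻¹ * iteratedDeriv k (fun x => f (axisPoint n i x)) 0) * s ^ k := by
    intro k
    have h1 : ((C * polylogCoeff n m k : ℝ) : ℂ) *
        ((Real.pi ^ (n + m) / (μ ^ n * polylogCoeff n m k) : ℝ) : ℂ) = 1 := by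
      rw [← Complex.ofReal_mul]
      have := hc k
      have h2 := Real.pi_pos
      simp only [C]
      norm_cast
      field_simp
    simp only [hFdef]
    rw [integral_const_mul, integral_mul_conj_pow hμ hf hfi]
    push_cast at h1 ⊢
    linear_combination ((k.factorial : ℂ)⁻¹ *
      iteratedDeriv k (fun x => f (axisPoint n i x)) 0 * s ^ k) * h1
  simp only [hterm] at hsum
  have hgd : DifferentiableOn ℂ (fun x => f (axisPoint n i x)) (Metric.ball 0 1) :=
    hf.comp (differentiable_axisPoint i).differentiableOn
      fun x hx => axisPoint_mem i (mem_ball_zero_iff.1 hx)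
  rw [(hasSum_taylor_disc hgd hs).unique hsum]
  refine setIntegral_congr_fun isOpen_fbhDomain.measurableSet fun p hp => ?_
  have ht : ‖p.2 i * starRingEnd ℂ s‖ < 1 := by
    rw [norm_mul, RCLike.norm_conj]
    exact mul_lt_one_of_nonneg_of_lt_one_left (norm_nonneg _) (norm_apply_lt_one hμ hp i) hs.le
  have h1 := (hasSum_polylogNumerator n m ht).mapL Complex.conjCLE.toContinuousLinearMap
  have h2 := (h1.mul_left (C : ℂ)).mul_left (f p)
  have h3 : HasSum (fun k => F k p) (f p * starRingEnd ℂ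
      (C * polylogDeriv n m (p.2 i * starRingEnd ℂ s))) := by
    rw [map_mul, Complex.conj_ofReal]
    refine h2.congr_fun fun k => ?_
    simp [hFdef]
    ring
  exact h3.tsum_eq

end BasePoint

/-! ### The Bergman kernel of the Fock–Bargmann–Hartogs domain -/

section Kernel

/-- The Bergman kernel of the Fock–Bargmann–Hartogs domain, in closed form. -/
def fbhKernel (μ : ℝ) (n m : ℕ) (p q : (Fin n → ℂ) × (Fin m → ℂ)) : ℂ :=
  (μ ^ n / Real.pi ^ (n + m) : ℝ) * Complex.exp (μ * herm p.1 q.1) ^ m *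
    polylogDeriv n m (Complex.exp (μ * herm p.1 q.1) * herm p.2 q.2)

variable {μ : ℝ} {n m : ℕ}

lemma norm_exp_herm_mul_herm_lt (hμ : 0 < μ) {p q : (Fin n → ℂ) × (Fin m → ℂ)}
    (hp : p ∈ fbhDomain μ n m) (hq : q ∈ fbhDomain μ n m) :
    ‖Complex.exp (μ * herm p.1 q.1) * herm p.2 q.2‖ < 1 := by
  rw [mem_fbhDomain] at hp hq
  have h1 : 2 * (herm p.1 q.1).re ≤ sqNorm p.1 + sqNorm q.1 := by
    have h := sqNorm_add p.1 ((-1 : ℂ) • q.1)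
    rw [herm_smul_right, sqNorm_smul] at h
    have h0 := sqNorm_nonneg (p.1 + (-1 : ℂ) • q.1)
    rw [h] at h0
    simp at h0
    linarith
  have h2 : ‖herm p.2 q.2‖ ^ 2 < Real.exp (-μ * sqNorm p.1) * Real.exp (-μ * sqNorm q.1) :=
    (norm_herm_sq_le _ _).trans_lt (mul_lt_mul'' hp hq (sqNorm_nonneg _) (sqNorm_nonneg _))
  have h3 : ‖Complex.exp (μ * herm p.1 q.1)‖ ^ 2 ≤
      Real.exp (μ * (sqNorm p.1 + sqNorm q.1)) := by
    rw [Complex.norm_exp, ← Real.exp_nat_mul, Real.exp_le_exp, Complex.re_ofReal_mul]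
    push_cast
    nlinarith
  rw [← sq_lt_one_iff₀ (norm_nonneg _), norm_mul, mul_pow]
  calc ‖Complex.exp (μ * herm p.1 q.1)‖ ^ 2 * ‖herm p.2 q.2‖ ^ 2
      < Real.exp (μ * (sqNorm p.1 + sqNorm q.1)) *
        (Real.exp (-μ * sqNorm p.1) * Real.exp (-μ * sqNorm q.1)) := by
        refine mul_lt_mul' h3 h2 (by positivity) (Real.exp_pos _)
    _ = 1 := by
        rw [← Real.exp_add, ← Real.exp_add, ← Real.exp_zero]
        congr 1
        ring

lemma differentiableOn_fbhKernel (hμ : 0 < μ) {q : (Fin n → ℂ) × (Fin m → ℂ)}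
    (hq : q ∈ fbhDomain μ n m) :
    DifferentiableOn ℂ (fun p => fbhKernel μ n m p q) (fbhDomain μ n m) := by
  intro p hp
  have h1 : Differentiable ℂ fun p : (Fin n → ℂ) × (Fin m → ℂ) => herm p.1 q.1 := by
    unfold herm
    fun_prop
  have h2 : Differentiable ℂ fun p : (Fin n → ℂ) × (Fin m → ℂ) => herm p.2 q.2 := by
    unfold herm
    fun_prop
  have h3 : Differentiable ℂ fun p : (Fin n → ℂ) × (Fin m → ℂ) =>
      Complex.exp (μ * herm p.1 q.1) * herm p.2 q.2 := by fun_prop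
  have h4 : DifferentiableAt ℂ (fun p : (Fin n → ℂ) × (Fin m → ℂ) =>
      polylogDeriv n m (Complex.exp (μ * herm p.1 q.1) * herm p.2 q.2)) p :=
    DifferentiableAt.comp (g := polylogDeriv n m) p
      (differentiableAt_polylogDeriv n m (norm_exp_herm_mul_herm_lt hμ hp hq)) (h3 p)
  have h5 : DifferentiableAt ℂ (fun p : (Fin n → ℂ) × (Fin m → ℂ) => herm p.1 q.1) p := h1 p
  unfold fbhKernel
  exact DifferentiableAt.differentiableWithinAt (by fun_prop)

lemma fbhKernel_axisPoint (i : Fin m) (s : ℂ) (p : (Fin n → ℂ) × (Fin m → ℂ)) :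
    fbhKernel μ n m p (axisPoint n i s) =
      (μ ^ n / Real.pi ^ (n + m) : ℝ) * polylogDeriv n m (p.2 i * starRingEnd ℂ s) := by
  simp [fbhKernel, axisPoint]

lemma memBergmanSpace_fbhKernel_axisPoint [hμ : Fact (0 < μ)] (i : Fin m) {s : ℂ} (hs : ‖s‖ < 1) :
    MemBergmanSpace (fbhDomain μ n m) (fun p => fbhKernel μ n m p (axisPoint n i s)) := by
  have : NeZero m := ⟨i.pos.ne'⟩
  have hd := differentiableOn_fbhKernel (n := n) hμ.out (axisPoint_mem (μ := μ) (n := n) i hs)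
  refine ⟨hd, ?_⟩
  have hcont : ContinuousOn (polylogDeriv n m) (Metric.closedBall 0 ‖s‖) := fun t ht =>
    (differentiableAt_polylogDeriv n m
      ((mem_closedBall_zero_iff.1 ht).trans_lt hs)).continuousAt.continuousWithinAt
  obtain ⟨B, hB⟩ := (isCompact_closedBall (0 : ℂ) ‖s‖).exists_bound_of_continuousOn hcont
  refine MemLp.of_bound (hd.continuousOn.aestronglyMeasurable isOpen_fbhDomain.measurableSet)
    (‖((μ ^ n / Real.pi ^ (n + m) : ℝ) : ℂ)‖ * B) ?_
  filter_upwards [ae_restrict_mem isOpen_fbhDomain.measurableSet] with p hp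
  rw [fbhKernel_axisPoint, norm_mul]
  gcongr
  refine hB _ (mem_closedBall_zero_iff.2 ?_)
  rw [norm_mul, RCLike.norm_conj]
  exact mul_le_of_le_one_left (norm_nonneg _) (norm_apply_lt_one hμ.out hp i).le

end Kernel

/-! ### Transport by automorphisms -/

section Automorphism

variable {μ : ℝ} {n m : ℕ}

/-- The factor by which the automorphism over the translation `z ↦ z + a` scales `ζ`. -/
def autFactor (μ : ℝ) (a z : Fin n → ℂ) : ℂ :=
  Complex.exp (-(μ * herm z a) - μ * sqNorm a / 2)

/-- The automorphism `(z, ζ) ↦ (z + a, c(z) U ζ)`, for `U` unitary. Its complex Jacobian determinant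
is `c(z) ^ m` up to the constant `det U`. -/
def fbhAut (μ : ℝ) (a : Fin n → ℂ) (U : (Fin m → ℂ) →ₗ[ℂ] (Fin m → ℂ))
    (p : (Fin n → ℂ) × (Fin m → ℂ)) : (Fin n → ℂ) × (Fin m → ℂ) :=
  (p.1 + a, autFactor μ a p.1 • U p.2)

lemma autFactor_ne_zero (a z : Fin n → ℂ) : autFactor μ a z ≠ 0 := Complex.exp_ne_zero _

lemma differentiable_autFactor (a : Fin n → ℂ) : Differentiable ℂ (autFactor μ a) := by
  unfold autFactor herm
  fun_prop

lemma differentiable_fbhAut (a : Fin n → ℂ) (U : (Fin m → ℂ) →ₗ[ℂ] (Fin m → ℂ)) :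
    Differentiable ℂ (fbhAut μ a U) := by
  have h1 : Differentiable ℂ U := (LinearMap.toContinuousLinearMap U).differentiable
  have h2 := differentiable_autFactor (μ := μ) a
  exact (differentiable_fst.add_const a).prodMk
    ((h2.comp differentiable_fst).smul (h1.comp differentiable_snd))

lemma norm_autFactor_sq (a z : Fin n → ℂ) :
    ‖autFactor μ a z‖ ^ 2 * Real.exp (-μ * sqNorm z) = Real.exp (-μ * sqNorm (z + a)) := by
  have h : (-(μ * herm z a) - μ * sqNorm a / 2 : ℂ).re =
      -(μ * (herm z a).re) - μ * sqNorm a / 2 := by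
    have : (μ * sqNorm a / 2 : ℂ) = ((μ * sqNorm a / 2 : ℝ) : ℂ) := by push_cast; rfl
    rw [this, Complex.sub_re, Complex.neg_re, Complex.re_ofReal_mul, Complex.ofReal_re]
  rw [autFactor, Complex.norm_exp, h, ← Real.exp_nat_mul, ← Real.exp_add, sqNorm_add]
  congr 1
  push_cast
  ring

lemma exp_herm_add_mul_autFactor (a z w : Fin n → ℂ) :
    Complex.exp (μ * herm (z + a) (w + a)) *
      (autFactor μ a z * starRingEnd ℂ (autFactor μ a w)) = Complex.exp (μ * herm z w) := by
  have h : starRingEnd ℂ (autFactor μ a w) =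
      Complex.exp (-(μ * herm a w) - μ * sqNorm a / 2) := by
    rw [autFactor, ← Complex.exp_conj, ← herm_conj w a]
    simp [Complex.conj_ofNat]
  rw [h, autFactor, ← Complex.exp_add, ← Complex.exp_add, herm_add_left, herm_add_right,
    herm_add_right, herm_self]
  congr 1
  ring

lemma fbhAut_mem_iff {a : Fin n → ℂ} {U : (Fin m → ℂ) →ₗ[ℂ] (Fin m → ℂ)}
    (hU : ∀ x y, herm (U x) (U y) = herm x y) (p : (Fin n → ℂ) × (Fin m → ℂ)) :
    fbhAut μ a U p ∈ fbhDomain μ n m ↔ p ∈ fbhDomain μ n m := by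
  have hU' : sqNorm (U p.2) = sqNorm p.2 := by
    have := hU p.2 p.2
    rw [herm_self, herm_self] at this
    exact_mod_cast this
  have h0 : 0 < ‖autFactor μ a p.1‖ ^ 2 := by
    have := norm_pos_iff.2 (autFactor_ne_zero (μ := μ) a p.1)
    positivity
  rw [mem_fbhDomain, mem_fbhDomain, fbhAut, sqNorm_smul, ← norm_autFactor_sq, hU',
    mul_lt_mul_iff_right₀ h0]

/-- The transformation law of the kernel. -/
lemma fbhKernel_fbhAut {a : Fin n → ℂ} {U : (Fin m → ℂ) →ₗ[ℂ] (Fin m → ℂ)}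
    (hU : ∀ x y, herm (U x) (U y) = herm x y) (p q : (Fin n → ℂ) × (Fin m → ℂ)) :
    fbhKernel μ n m (fbhAut μ a U p) (fbhAut μ a U q) *
      (autFactor μ a p.1 ^ m * starRingEnd ℂ (autFactor μ a q.1 ^ m)) = fbhKernel μ n m p q := by
  have h := exp_herm_add_mul_autFactor (μ := μ) a p.1 q.1
  have h1 : Complex.exp (μ * herm (p.1 + a) (q.1 + a)) *
      herm (autFactor μ a p.1 • U p.2) (autFactor μ a q.1 • U q.2) =
      Complex.exp (μ * herm p.1 q.1) * herm p.2 q.2 := by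
    rw [herm_smul_left, herm_smul_right, hU, ← h]
    ring
  simp only [fbhKernel, fbhAut]
  rw [h1, ← h, map_pow]
  ring

/-- The change of variables formula for `fbhAut`, as an identity of measures. -/
lemma map_fbhAut_withDensity {a : Fin n → ℂ} {U : (Fin m → ℂ) →ₗ[ℂ] (Fin m → ℂ)}
    (hU : ∀ x y, herm (U x) (U y) = herm x y) :
    Measure.map (fbhAut μ a U) ((volume.restrict (fbhDomain μ n m)).withDensity
      fun p => ENNReal.ofReal (‖autFactor μ a p.1‖ ^ (2 * m))) =
      volume.restrict (fbhDomain μ n m) := by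
  have hΩ := (isOpen_fbhDomain (μ := μ) (n := n) (m := m)).measurableSet
  have hΦ : Measurable (fbhAut μ a U) := (differentiable_fbhAut a U).continuous.measurable
  have hc : Measurable (autFactor μ a) := (differentiable_autFactor a).continuous.measurable
  have hU' : ∀ x, sqNorm (U x) = sqNorm x := fun x => by
    have := hU x x
    rw [herm_self, herm_self] at this
    exact_mod_cast this
  refine Measure.ext fun s hs => ?_
  have hset : fbhAut μ a U ⁻¹' s ∩ fbhDomain μ n m = fbhAut μ a U ⁻¹' (s ∩ fbhDomain μ n m) := by
    ext p
    simp [fbhAut_mem_iff hU]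
  have hm : MeasurableSet (s ∩ fbhDomain μ n m) := hs.inter hΩ
  rw [Measure.map_apply hΦ hs, withDensity_apply _ (hΦ hs), Measure.restrict_restrict (hΦ hs),
    hset, Measure.restrict_apply hs, ← lintegral_indicator (hΦ hm),
    ← lintegral_indicator_one hm, Measure.volume_eq_prod,
    lintegral_prod _ (Measurable.aemeasurable (Measurable.indicator (by fun_prop) (hΦ hm))),
    lintegral_prod _ (Measurable.aemeasurable (measurable_one.indicator hm))]
  have hinner : ∀ z : Fin n → ℂ, ∫⁻ ζ : Fin m → ℂ,
      (fbhAut μ a U ⁻¹' (s ∩ fbhDomain μ n m)).indicator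
        (fun p => ENNReal.ofReal (‖autFactor μ a p.1‖ ^ (2 * m))) (z, ζ) =
      ∫⁻ ζ : Fin m → ℂ, (s ∩ fbhDomain μ n m).indicator 1 (z + a, ζ) := fun z => by
    have h := lintegral_comp_similarity (L := autFactor μ a z • U)
      (norm_pos_iff.2 (autFactor_ne_zero a z))
      (fun x => by rw [LinearMap.smul_apply, sqNorm_smul, hU'])
      (g := fun ζ => (s ∩ fbhDomain μ n m).indicator 1 (z + a, ζ))
      ((measurable_one.indicator hm).comp measurable_prodMk_left)
    rw [← h, Fintype.card_fin]
    refine lintegral_congr fun ζ => ?_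
    by_cases hmem : fbhAut μ a U (z, ζ) ∈ s ∩ fbhDomain μ n m
    · rw [Set.indicator_of_mem (show (z, ζ) ∈ fbhAut μ a U ⁻¹' (s ∩ fbhDomain μ n m) from hmem)]
      rw [show (z + a, (autFactor μ a z • U) ζ) = fbhAut μ a U (z, ζ) from rfl,
        Set.indicator_of_mem hmem, Pi.one_apply, one_mul]
    · rw [Set.indicator_of_notMem (show (z, ζ) ∉ fbhAut μ a U ⁻¹' (s ∩ fbhDomain μ n m) from hmem)]
      rw [show (z + a, (autFactor μ a z • U) ζ) = fbhAut μ a U (z, ζ) from rfl,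
        Set.indicator_of_notMem hmem, zero_mul]
  rw [lintegral_congr hinner]
  exact lintegral_add_right_eq_self
    (fun z : Fin n → ℂ => ∫⁻ ζ : Fin m → ℂ, (s ∩ fbhDomain μ n m).indicator 1 (z, ζ)) a

lemma lintegral_fbhAut {a : Fin n → ℂ} {U : (Fin m → ℂ) →ₗ[ℂ] (Fin m → ℂ)}
    (hU : ∀ x y, herm (U x) (U y) = herm x y) {g : (Fin n → ℂ) × (Fin m → ℂ) → ENNReal}
    (hg : AEMeasurable g (volume.restrict (fbhDomain μ n m))) :
    ∫⁻ p in fbhDomain μ n m, ENNReal.ofReal (‖autFactor μ a p.1‖ ^ (2 * m)) * g (fbhAut μ a U p) =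
      ∫⁻ p in fbhDomain μ n m, g p := by
  have hΦ : Measurable (fbhAut μ a U) := (differentiable_fbhAut a U).continuous.measurable
  have hc : Measurable (autFactor μ a) := (differentiable_autFactor a).continuous.measurable
  have hmap := map_fbhAut_withDensity (μ := μ) (a := a) hU
  conv_rhs => rw [← hmap]
  rw [lintegral_map' (by rwa [hmap]) hΦ.aemeasurable,
    lintegral_withDensity_eq_lintegral_mul_non_measurable _ (by fun_prop)
      (Filter.Eventually.of_forall fun p => ENNReal.ofReal_lt_top)]
  rfl

lemma integral_fbhAut {a : Fin n → ℂ} {U : (Fin m → ℂ) →ₗ[ℂ] (Fin m → ℂ)}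
    (hU : ∀ x y, herm (U x) (U y) = herm x y) {g : (Fin n → ℂ) × (Fin m → ℂ) → ℂ}
    (hg : AEStronglyMeasurable g (volume.restrict (fbhDomain μ n m))) :
    ∫ p in fbhDomain μ n m, (‖autFactor μ a p.1‖ ^ (2 * m)) • g (fbhAut μ a U p) =
      ∫ p in fbhDomain μ n m, g p := by
  have hΦ : Measurable (fbhAut μ a U) := (differentiable_fbhAut a U).continuous.measurable
  have hc : Measurable (autFactor μ a) := (differentiable_autFactor a).continuous.measurable
  have hmap := map_fbhAut_withDensity (μ := μ) (a := a) hU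
  conv_rhs => rw [← hmap]
  rw [integral_map hΦ.aemeasurable (by rwa [hmap]),
    integral_withDensity_eq_integral_toReal_smul (by fun_prop)
      (Filter.Eventually.of_forall fun p => ENNReal.ofReal_lt_top)]
  refine integral_congr_ae (Filter.Eventually.of_forall fun p => ?_)
  simp only
  rw [ENNReal.toReal_ofReal (by positivity)]

lemma memLp_two_iff_lintegral {f : (Fin n → ℂ) × (Fin m → ℂ) → ℂ}
    (hf : DifferentiableOn ℂ f (fbhDomain μ n m)) :
    MemLp f 2 (volume.restrict (fbhDomain μ n m)) ↔
      ∫⁻ p in fbhDomain μ n m, ENNReal.ofReal (‖f p‖ ^ 2) < ⊤ := by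
  have hm := hf.continuousOn.aestronglyMeasurable
    (isOpen_fbhDomain (μ := μ) (n := n) (m := m)).measurableSet (μ := volume)
  rw [memLp_two_iff_integrable_sq_norm hm, Integrable, hasFiniteIntegral_iff_ofReal
    (Filter.Eventually.of_forall fun p => by positivity)]
  exact and_iff_right (hm.norm.pow 2)

lemma aemeasurable_ofReal_norm_sq {f : (Fin n → ℂ) × (Fin m → ℂ) → ℂ}
    (hf : DifferentiableOn ℂ f (fbhDomain μ n m)) :
    AEMeasurable (fun p => ENNReal.ofReal (‖f p‖ ^ 2)) (volume.restrict (fbhDomain μ n m)) := by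
  have hm := hf.continuousOn.aestronglyMeasurable
    (isOpen_fbhDomain (μ := μ) (n := n) (m := m)).measurableSet (μ := volume)
  exact (hm.norm.aemeasurable.pow_const 2).ennreal_ofReal

/-- Composition with an automorphism, multiplied by its Jacobian, preserves the Bergman space. -/
lemma MemBergmanSpace.comp_fbhAut {a : Fin n → ℂ} {U : (Fin m → ℂ) →ₗ[ℂ] (Fin m → ℂ)}
    (hU : ∀ x y, herm (U x) (U y) = herm x y) {f : (Fin n → ℂ) × (Fin m → ℂ) → ℂ}
    (hf : MemBergmanSpace (fbhDomain μ n m) f) :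
    MemBergmanSpace (fbhDomain μ n m)
      (fun p => f (fbhAut μ a U p) * autFactor μ a p.1 ^ m) := by
  have hd : DifferentiableOn ℂ (fun p => f (fbhAut μ a U p) * autFactor μ a p.1 ^ m)
      (fbhDomain μ n m) := by
    refine DifferentiableOn.mul (hf.1.comp (differentiable_fbhAut a U).differentiableOn
      fun p hp => (fbhAut_mem_iff hU p).2 hp) ?_
    have := differentiable_autFactor (μ := μ) a
    exact Differentiable.differentiableOn (by fun_prop)
  refine ⟨hd, (memLp_two_iff_lintegral hd).2 ?_⟩
  have h := (memLp_two_iff_lintegral hf.1).1 hf.2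
  rw [← lintegral_fbhAut (a := a) hU (aemeasurable_ofReal_norm_sq hf.1)] at h
  refine (lintegral_congr fun p => ?_).trans_lt h
  rw [← ENNReal.ofReal_mul (by positivity), norm_mul, norm_pow]
  congr 1
  ring

/-- Every point of the domain is the image of a point of the axis under an automorphism. -/
lemma exists_fbhAut_axisPoint (i : Fin m) {q : (Fin n → ℂ) × (Fin m → ℂ)}
    (hq : q ∈ fbhDomain μ n m) :
    ∃ (U : (Fin m → ℂ) →ₗ[ℂ] (Fin m → ℂ)) (s : ℂ), (∀ x y, herm (U x) (U y) = herm x y) ∧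
      ‖s‖ < 1 ∧ fbhAut μ q.1 U (axisPoint n i s) = q := by
  set c := autFactor μ q.1 0
  have hc : c ≠ 0 := autFactor_ne_zero _ _
  obtain ⟨U, hU, hUs⟩ := exists_unitary i (c⁻¹ • q.2)
  refine ⟨U, (Real.sqrt (sqNorm (c⁻¹ • q.2)) : ℂ), hU, ?_, ?_⟩
  · have h1 : sqNorm (c⁻¹ • q.2) < 1 := by
      have h2 : ‖c‖ ^ 2 = Real.exp (-μ * sqNorm q.1) := by
        have := norm_autFactor_sq (μ := μ) q.1 0
        simpa [sqNorm] using this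
      rw [sqNorm_smul, norm_inv, inv_pow, h2, inv_mul_lt_one₀ (Real.exp_pos _)]
      exact mem_fbhDomain.1 hq
    rw [Complex.norm_real, Real.norm_eq_abs, abs_of_nonneg (Real.sqrt_nonneg _),
      Real.sqrt_lt' one_pos, one_pow]
    exact h1
  · simp only [fbhAut, axisPoint]
    rw [hUs, zero_add, smul_smul, mul_inv_cancel₀ hc, one_smul]

theorem isBergmanKernel_fbhKernel (hμ : 0 < μ) (hm : 1 ≤ m) :
    IsBergmanKernel (fbhDomain μ n m) (fbhKernel μ n m) := by
  have : Fact (0 < μ) := ⟨hμ⟩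
  have : NeZero m := ⟨by omega⟩
  intro q hq
  obtain ⟨U, s, hU, hs, hqs⟩ := exists_fbhAut_axisPoint (0 : Fin m) hq
  set a := q.1
  set e := axisPoint n (0 : Fin m) s
  set J : (Fin n → ℂ) × (Fin m → ℂ) → ℂ := fun p => autFactor μ a p.1 ^ m
  have hJ : ∀ p, J p ≠ 0 := fun p => pow_ne_zero _ (autFactor_ne_zero _ _)
  have hK : ∀ p, fbhKernel μ n m (fbhAut μ a U p) q * (J p * starRingEnd ℂ (J e)) =
      fbhKernel μ n m p e := fun p => by
    rw [← fbhKernel_fbhAut hU p e, hqs]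
  have hJn : ∀ p : (Fin n → ℂ) × (Fin m → ℂ),
      ‖autFactor μ a p.1‖ ^ (2 * m) = ‖J p‖ ^ 2 := fun p => by
    simp only [J, norm_pow]
    ring
  have hd := differentiableOn_fbhKernel (m := m) hμ hq
  have hmem : MemBergmanSpace (fbhDomain μ n m) (fun p => fbhKernel μ n m p q) := by
    refine ⟨hd, (memLp_two_iff_lintegral hd).2 ?_⟩
    rw [← lintegral_fbhAut (a := a) hU (aemeasurable_ofReal_norm_sq hd)]
    have h := memBergmanSpace_fbhKernel_axisPoint (μ := μ) (n := n) (0 : Fin m) hs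
    have h1 := (memLp_two_iff_lintegral h.1).1 h.2
    have h2 := ENNReal.mul_lt_top (ENNReal.ofReal_lt_top (r := (‖J e‖ ^ 2)⁻¹)) h1
    rw [← lintegral_const_mul' _ _ ENNReal.ofReal_ne_top] at h2
    refine (lintegral_congr fun p => ?_).trans_lt h2
    rw [← ENNReal.ofReal_mul (by positivity), ← ENNReal.ofReal_mul (by positivity), hJn, ← hK p,
      norm_mul, norm_mul, RCLike.norm_conj]
    have := norm_pos_iff.2 (hJ e)
    congr 1
    field_simp
  refine ⟨hmem, fun f hf => ?_⟩
  have hg := hf.comp_fbhAut (a := a) hU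
  have hrep := eq_integral_axisPoint hμ hg.1 hg.integrable (0 : Fin m) hs
  simp only [← fbhKernel_axisPoint] at hrep
  have hmeas : AEStronglyMeasurable (fun p => f p * starRingEnd ℂ (fbhKernel μ n m p q))
      (volume.restrict (fbhDomain μ n m)) :=
    hf.2.aestronglyMeasurable.mul
      (Complex.continuous_conj.comp_aestronglyMeasurable hmem.2.aestronglyMeasurable)
  rw [← integral_fbhAut (a := a) hU hmeas]
  refine mul_right_cancel₀ (hJ e) ?_
  calc f q * J e = ∫ p in fbhDomain μ n m, f (fbhAut μ a U p) * J p *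
        starRingEnd ℂ (fbhKernel μ n m p e) := by
        rw [← hrep]
        simp only [J]
        rw [hqs]
    _ = _ := by
        rw [← integral_mul_const]
        refine integral_congr_ae (Filter.Eventually.of_forall fun p => ?_)
        have h : J p * starRingEnd ℂ (J p) = ((‖J p‖ ^ 2 : ℝ) : ℂ) := by
          rw [Complex.mul_conj, Complex.normSq_eq_norm_sq]
        simp only
        rw [← hK p, hJn, Complex.real_smul, ← h]
        simp only [map_mul, Complex.conj_conj]
        ring

end Automorphism

/-! ### Zeros of the kernel -/

section LuQiKeng

lemma IsBergmanKernel.unique {E : Type*} [NormedAddCommGroup E] [NormedSpace ℂ E] [MeasureSpace E]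
    {Ω : Set E} {K K' : E → E → ℂ} (hK : IsBergmanKernel Ω K) (hK' : IsBergmanKernel Ω K')
    {z w : E} (hz : z ∈ Ω) (hw : w ∈ Ω) : K z w = K' z w := by
  -- pairing `K(·, w)` with `K'(·, z)` in both orders shows `K(z, w) = conj K'(w, z)`
  have key : ∀ {K₁ K₂ : E → E → ℂ}, IsBergmanKernel Ω K₁ → IsBergmanKernel Ω K₂ →
      ∀ {z w : E}, z ∈ Ω → w ∈ Ω → K₁ z w = starRingEnd ℂ (K₂ w z) := by
    intro K₁ K₂ h₁ h₂ z w hz hw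
    rw [(h₂ z hz).2 _ (h₁ w hw).1, (h₁ w hw).2 _ (h₂ z hz).1, ← integral_conj]
    simp [mul_comm]
  rw [key hK hK hz hw, key hK' hK hz hw]

variable {μ : ℝ} {n m : ℕ}

lemma isLuQiKeng_fbhDomain_iff (hμ : 0 < μ) (hm : 1 ≤ m) :
    IsLuQiKeng (fbhDomain μ n m) ↔ NoZeroInDisc n m := by
  have hker := isBergmanKernel_fbhKernel (n := n) hμ hm
  have hC : ((μ ^ n / Real.pi ^ (n + m) : ℝ) : ℂ) ≠ 0 := by
    have := Real.pi_pos
    exact_mod_cast (by positivity : (0 : ℝ) < μ ^ n / Real.pi ^ (n + m)).ne'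
  constructor
  · rintro ⟨K, hK, hne⟩ t ht
    -- `t` is the value of `⟨ζ, ω⟩` at the points `ζ = (t / r) e_i` and `ω = r e_i`
    obtain ⟨r, hr, hr1⟩ := exists_between ht
    have hr0 : 0 < r := (norm_nonneg t).trans_lt hr
    have h1 : ‖t / r‖ < 1 := by
      rw [norm_div, Complex.norm_real, Real.norm_eq_abs, abs_of_pos hr0, div_lt_one hr0]
      exact hr
    have h2 : ‖(r : ℂ)‖ < 1 := by
      rwa [Complex.norm_real, Real.norm_eq_abs, abs_of_pos hr0]
    set i : Fin m := ⟨0, by omega⟩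
    have hz := axisPoint_mem (μ := μ) (n := n) i h1
    have hw := axisPoint_mem (μ := μ) (n := n) i h2
    have h3 := hne _ hz _ hw
    rw [hK.unique hker hz hw, fbhKernel_axisPoint] at h3
    have h4 : (axisPoint n i (t / r)).2 i * starRingEnd ℂ (r : ℂ) = t := by
      have : (r : ℂ) ≠ 0 := by exact_mod_cast hr0.ne'
      simp [axisPoint, this]
    rw [h4] at h3
    exact (polylogDeriv_ne_zero_iff n m ht).1 (right_ne_zero_of_mul h3)
  · intro h
    refine ⟨_, hker, fun p hp q hq => ?_⟩
    have ht := norm_exp_herm_mul_herm_lt hμ hp hq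
    exact mul_ne_zero (mul_ne_zero hC (pow_ne_zero _ (Complex.exp_ne_zero _)))
      ((polylogDeriv_ne_zero_iff n m ht).2 (h _ ht))

end LuQiKeng

end

theorem theorem1 :
    -- (i), with the numerator polynomials `A n m` existing and being uniquely determined
    (∃ A : ℕ → ℕ → Polynomial ℝ,
      (∀ n m : ℕ, 1 ≤ n → 1 ≤ m → ∀ P : Polynomial ℝ, IsPolylogNumerator n m P ↔ P = A n m) ∧
      (∀ n m : ℕ, 1 ≤ n → 1 ≤ m →
        RootsRealSimpleNegative (A n m) ∧ RootsRealSimpleNegative (A n (m + 1)) ∧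
        StrictlyAlternates (A n (m + 1)) (A n m))) ∧
    -- (ii), with the Bergman kernel existing and `m₀` not depending on `μ`
    (∀ n : ℕ, 1 ≤ n →
      ∃! m₀ : ℕ, 1 ≤ m₀ ∧ ∀ μ : ℝ, 0 < μ → ∀ m : ℕ, 1 ≤ m →
        (∃ K, IsBergmanKernel (fbhDomain μ n m) K) ∧
        (IsLuQiKeng (fbhDomain μ n m) ↔ m₀ ≤ m)) := by
  refine ⟨⟨polylogNumerator, fun n m hn _ P => isPolylogNumerator_iff hn P,
    fun n m _ hm => polylogNumerator_alternates hm⟩, fun n _ => ?_⟩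
  classical
  have hex := exists_noZeroInDisc n
  have hspec := Nat.find_spec hex
  refine ⟨Nat.find hex, ⟨hspec.1, fun μ hμ m hm => ⟨⟨_, isBergmanKernel_fbhKernel hμ hm⟩, ?_⟩⟩, ?_⟩
  · rw [isLuQiKeng_fbhDomain_iff hμ hm]
    exact ⟨fun h => Nat.find_min' hex ⟨hm, h⟩, hspec.2.mono⟩
  · rintro k ⟨hk, H⟩
    have hiff : ∀ m, 1 ≤ m → (NoZeroInDisc n m ↔ k ≤ m) := fun m hm =>
      (isLuQiKeng_fbhDomain_iff one_pos hm).symm.trans (H 1 one_pos m hm).2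
    exact le_antisymm ((hiff _ hspec.1).1 hspec.2)
      (Nat.find_min' hex ⟨hk, (hiff k hk).2 le_rfl⟩)
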